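/- Let $\mathbb H$ be the upper half-plane and let $$E_5:=\bigcup_{\substack{a,b,c\in\mathbb Z\\ b^2-4ac=5}}\{\tau\in\mathbb H : a|\tau|^2+b\,\mathrm{Re}(\tau)+c=0\}.$$ A \emph{modular local polynomial of weight $-2$ with exceptional set $E_5$} is a function $\mathcal P:\mathbb H\to\mathbb C$ such that (1) $\mathcal P\left(\frac{a\tau+b}{c\tau+d}\right)=(c\tau+d)^{-2}\mathcal P(\tau)$ for all $\tau\in\mathbb H$ and all $\left(\begin{smallmatrix}a&b\\c&d\end{smallmatrix}\right)\in \mathrm{SL}_2(\mathbb Z)$; (2) on every connected component of $\mathbb H\setminus E_5$, $\mathcal P$ agrees with a polynomial in $\tau$ with complex coefficients; (3) for every $\tau\in\mathbb H$, if $\mathfrak C_\tau$ denotes the set of connected components $\mathcal C$ of $\mathbb H\setminus E_5$ with $\tau\in\mathcal C\cup\partial\mathcal C$, then $\mathfrak C_\tau$ is finite and non-empty, the limits below exist, and $$\mathcal P(\tau)=\frac{1}{\#\mathfrak C_\tau}\sum_{\mathcal C\in\mathfrak C_\tau}\ \lim_{\substack{w\to\tau\\ w\in\mathcal C}}\mathcal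 P(w).$$ The modular local polynomials of weight $-2$ with exceptional set $E_5$ form a complex vector space of dimension exactly $2$. There is a connected component $\mathcal C_\infty$ of $\mathbb H\setminus E_5$ containing all $\tau\in\mathbb H$ with $\mathrm{Im}(\tau)>\frac{\sqrt5}{2}$, and a connected component $\mathcal C_\rho$ of $\mathbb H\setminus E_5$ containing $\rho:=e^{\pi i/3}$. Every element of the space is uniquely determined by its values on $\mathcal C_\infty\cup\mathcal C_\rho$, and the elements are precisely the functions $\mathcal P_{\alpha,\beta}$ with $\alpha,\beta\in\mathbb C$ arbitrary, where $\mathcal P_{\alpha,\beta}$ is the unique modular local polynomial of weight $-2$ with exceptional set $E_5$ satisfying $$\mathcal P_{\alpha,\beta}(\tau)=\begin{cases}\alpha & \text{if }\tau\in\mathcal C_\infty,\\ \beta(\tau^2-\tau+1)&\text{if }\tau\in\mathcal C_\rho.\end{cases}$$ -/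

import Mathlib

open Filter Topology
open scoped UpperHalfPlane MatrixGroups ModularForm

/-- The connected components of `ℍ \ E`. -/
def complementComponents (E : Set ℍ) : Set (Set ℍ) :=
  {C | ∃ τ ∈ Eᶜ, C = connectedComponentIn Eᶜ τ}

/-- `f` is a local polynomial with exceptional set `E`: on every connected component of `ℍ \ E`
it agrees with a polynomial in `τ`; nothing is required on `E` itself. -/
def IsLocalPolynomial (E : Set ℍ) (f : ℍ → ℂ) : Prop :=
  ∀ C ∈ complementComponents E, ∃ P : Polynomial ℂ, ∀ τ ∈ C, f τ = P.eval (τ : ℂ)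

/-- The connected components `C` of `ℍ \ E` with `τ ∈ C ∪ ∂C`, the boundary being taken in `ℍ`. -/
def adjacentComponents (E : Set ℍ) (τ : ℍ) : Set (Set ℍ) :=
  {C | C ∈ complementComponents E ∧ τ ∈ C ∪ frontier C}

/-- The average at `τ` of the limits of `f` along the components of `ℍ \ E` adjacent to `τ`
exists and equals `a`: there are finitely many (and at least one) adjacent components, the limit
`L C` of `f w` for `w → τ`, `w ∈ C` exists for each of them, and `a` is the mean of the `L C`. -/
def HasAverageAt (E : Set ℍ) (f : ℍ → ℂ) (τ : ℍ) (a : ℂ) : Prop :=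
  ∃ (S : Finset (Set ℍ)) (L : Set ℍ → ℂ),
    (S : Set (Set ℍ)) = adjacentComponents E τ ∧ S.Nonempty ∧
    (∀ C ∈ S, Tendsto f (𝓝[C] τ) (𝓝 (L C))) ∧
    a = (1 / (S.card : ℂ)) * ∑ C ∈ S, L C

/-- Modular local polynomials of weight `k` for `SL(2, ℤ)` with exceptional set `E`. -/
structure IsModularLocalPolynomial (k : ℤ) (E : Set ℍ) (f : ℍ → ℂ) : Prop where
  slash_eq : ∀ γ : SL(2, ℤ), f ∣[k] γ = f
  isLocalPolynomial : IsLocalPolynomial E f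
  hasAverageAt : ∀ τ : ℍ, HasAverageAt E f τ (f τ)

/-- The geodesic `S_Q = {τ ∈ ℍ | a |τ|² + b Re τ + c = 0}` of the form `Q = [a, b, c]`. -/
def formGeodesic (a b c : ℤ) : Set ℍ :=
  {τ | (a : ℝ) * ‖(τ : ℂ)‖ ^ 2 + (b : ℝ) * τ.re + (c : ℝ) = 0}

/-- For `D > 0`, the union `E_D` of the geodesics `S_Q` over all integral binary quadratic forms
`Q = [a, b, c]` of discriminant `b² - 4ac = D`. -/
def exceptionalSet (D : ℤ) : Set ℍ :=
  {τ | ∃ a b c : ℤ, b ^ 2 - 4 * a * c = D ∧ τ ∈ formGeodesic a b c}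

/-- The set of modular local polynomials of weight `k` with exceptional set `E_D`. -/
def modularLocalPolynomials (k D : ℤ) : Set (ℍ → ℂ) :=
  {f | IsModularLocalPolynomial k (exceptionalSet D) f}

/-- The elliptic point `ρ = e^{πi/3}`. -/
noncomputable def rhoPoint : ℍ :=
  ⟨Complex.exp (Real.pi * Complex.I / 3), by
    have h : (Real.pi * Complex.I / 3 : ℂ) = ((Real.pi / 3 : ℝ) : ℂ) * Complex.I := by
      push_cast; ring
    rw [h, Complex.exp_ofReal_mul_I_im]
    apply Real.sin_pos_of_pos_of_lt_pi <;> linarith [Real.pi_pos]⟩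

/-! Modulo `SL(2, ℤ)` the complement of `E_5` has only two components, and each contributes one free
parameter.

A geodesic of discriminant 5 reaching above height 1/2 has leading coefficient ±1, so it is a circle
with centre `n + 1/2` and radius `√5 / 2` (`exists_circleForm_eq_zero`). Hence `upperRegion` and
`ellipticTriangle` are cut out by finitely or locally finitely many known circles and are full
components. A fundamental domain lies in their union together with one arc of `E_5`, so every
component is a translate of one of them.

Upper bound: translations preserve `upperRegion`, so the polynomial there is periodic, hence
constant. The rotation of order three about `ρ` preserves `ellipticTriangle`, and invariance in
weight `-2` leaves only multiples of `τ² - τ + 1` (`Polynomial.eq_of_rotation_invariant`). Values on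
the remaining components follow by modularity, and values on `E_5` by averaging
(`eq_of_eq_on_regions`).

Existence: the data `α`, `β (τ² - τ + 1)` spread along orbits without contradiction, because an
element carrying a region to itself preserves its polynomial in weight `-2`
(`autFactor_sq_eq_one_of_overlap`, `rhoForm_smul_of_overlap`) and no element carries one region to
the other. Only finitely many components are adjacent to a point (`finite_adjacentComponents`), so
the averages exist and define the values on `E_5`; uniqueness of averages makes the corrected
function modular. -/

/-! ### Two explicit regions of the upper half-plane -/

/-- The value of the quadratic form `[1, -(2n+1), n²+n-1]` of discriminant `5` at `τ`; it vanishes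
on the geodesic with centre `n + 1/2` and radius `√5 / 2`. -/
noncomputable def circleForm (n : ℤ) (τ : ℍ) : ℝ :=
  τ.re ^ 2 + τ.im ^ 2 - (2 * n + 1) * τ.re + (n ^ 2 + n - 1)

/-- The region above all geodesics with centre `n + 1/2` and radius `√5 / 2`. -/
def upperRegion : Set ℍ := {τ | ∀ n : ℤ, 0 < circleForm n τ}

/-- The geodesic triangle with vertices `i`, `i + 1` and `(i + 1) / 2`. -/
def ellipticTriangle : Set ℍ :=
  {τ | circleForm 0 τ < 0 ∧ 0 < circleForm (-1) τ ∧ 0 < circleForm 1 τ}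

lemma continuous_circleForm (n : ℤ) : Continuous (circleForm n) := by
  have h1 := UpperHalfPlane.continuous_re
  have h2 := UpperHalfPlane.continuous_im
  unfold circleForm
  fun_prop

lemma norm_coe_sq_eq (τ : ℍ) : ‖(τ : ℂ)‖ ^ 2 = τ.re ^ 2 + τ.im ^ 2 := by
  rw [Complex.sq_norm, Complex.normSq_apply, UpperHalfPlane.coe_re, UpperHalfPlane.coe_im]
  ring

lemma mem_formGeodesic_iff (a b c : ℤ) (τ : ℍ) :
    τ ∈ formGeodesic a b c ↔ (a : ℝ) * (τ.re ^ 2 + τ.im ^ 2) + b * τ.re + c = 0 := by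
  rw [← norm_coe_sq_eq]; rfl

lemma mem_exceptionalSet_of_circleForm_eq_zero {n : ℤ} {τ : ℍ} (h : circleForm n τ = 0) :
    τ ∈ exceptionalSet 5 := by
  refine ⟨1, -(2 * n + 1), n ^ 2 + n - 1, by ring, ?_⟩
  rw [mem_formGeodesic_iff, ← h, circleForm]
  push_cast
  ring

/-- A subset of the upper half-plane that is convex in the coordinates `(Re τ, |τ|²)` is
preconnected. -/
lemma isPreconnected_setOf_of_convex {K : Set (ℝ × ℝ)} (hK : Convex ℝ K) :
    IsPreconnected {τ : ℍ | (τ.re, τ.re ^ 2 + τ.im ^ 2) ∈ K} := by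
  -- In these coordinates `ℍ` is the strict epigraph of `x ↦ x²`, and `hcont` below concerns the
  -- inverse chart. Each `circleForm n` becomes affine there.
  have hconv : Convex ℝ (K ∩ {p : ℝ × ℝ | p.1 ∈ Set.univ ∧ p.1 ^ 2 < p.2}) :=
    hK.inter (ConvexOn.convex_strict_epigraph (f := fun x : ℝ => x ^ 2) even_two.convexOn_pow)
  have hcont : Continuous fun p : ℝ × ℝ => ((p.1 : ℂ) + (Real.sqrt (p.2 - p.1 ^ 2) : ℝ) * Complex.I) := by
    fun_prop
  have himg := hconv.isPreconnected.image _ hcont.continuousOn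
  rw [← UpperHalfPlane.isEmbedding_coe.isInducing.isPreconnected_image]
  convert himg using 1
  ext z
  constructor
  · rintro ⟨τ, hτ, rfl⟩
    refine ⟨(τ.re, τ.re ^ 2 + τ.im ^ 2), ⟨hτ, trivial, ?_⟩, ?_⟩
    · have := τ.im_pos
      simp only
      nlinarith
    · simp only [add_sub_cancel_left, Real.sqrt_sq τ.im_pos.le, UpperHalfPlane.re_add_im]
  · rintro ⟨p, ⟨hp, -, hlt⟩, rfl⟩
    have hpos : 0 < Real.sqrt (p.2 - p.1 ^ 2) := Real.sqrt_pos.2 (by linarith)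
    refine ⟨⟨(p.1 : ℂ) + (Real.sqrt (p.2 - p.1 ^ 2) : ℝ) * Complex.I, by simpa using hpos⟩, ?_, rfl⟩
    have hsq : Real.sqrt (p.2 - p.1 ^ 2) ^ 2 = p.2 - p.1 ^ 2 := Real.sq_sqrt (by linarith)
    have hp' : (p.1, p.1 ^ 2 + Real.sqrt (p.2 - p.1 ^ 2) ^ 2) ∈ K := by
      rwa [hsq, add_sub_cancel]
    rw [Set.mem_ofPred_eq, UpperHalfPlane.mk_re, UpperHalfPlane.mk_im]
    simpa using hp'

lemma isPreconnected_upperRegion : IsPreconnected upperRegion := by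
  have h : Convex ℝ {p : ℝ × ℝ | ∀ n : ℤ, 0 < p.2 - (2 * n + 1) * p.1 + (n ^ 2 + n - 1)} := by
    intro p hp q hq s t hs ht hst n
    have h1 := hp n
    have h2 := hq n
    have : 0 < s * (p.2 - (2 * n + 1) * p.1 + (n ^ 2 + n - 1)) +
        t * (q.2 - (2 * n + 1) * q.1 + (n ^ 2 + n - 1)) := by
      rcases hs.eq_or_lt with rfl | hs
      · have : t = 1 := by linarith
        subst this; linarith
      · have := mul_nonneg ht h2.le
        have := mul_pos hs h1
        linarith
    obtain rfl : t = 1 - s := by linarith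
    simp only [Prod.snd_add, Prod.smul_snd, smul_eq_mul, Prod.fst_add, Prod.smul_fst]
    linarith
  exact isPreconnected_setOf_of_convex h

lemma isPreconnected_ellipticTriangle : IsPreconnected ellipticTriangle := by
  have h : ∀ a b : ℝ, Convex ℝ {p : ℝ × ℝ | 0 < p.2 + a * p.1 + b} ∧
      Convex ℝ {p : ℝ × ℝ | p.2 + a * p.1 + b < 0} := by
    intro a b
    have hlin : IsLinearMap ℝ fun p : ℝ × ℝ => p.2 + a * p.1 :=
      ⟨fun x y => by simp; ring, fun c x => by simp; ring⟩
    constructor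
    · have : {p : ℝ × ℝ | 0 < p.2 + a * p.1 + b} = {p | -b < p.2 + a * p.1} :=
        Set.ext fun p => by simp only [Set.mem_ofPred_eq]; exact neg_lt_iff_pos_add.symm
      exact this ▸ convex_halfSpace_gt hlin (-b)
    · have : {p : ℝ × ℝ | p.2 + a * p.1 + b < 0} = {p | p.2 + a * p.1 < -b} :=
        Set.ext fun p => by simp only [Set.mem_ofPred_eq]; exact lt_neg_iff_add_neg.symm
      exact this ▸ convex_halfSpace_lt hlin (-b)
  convert isPreconnected_setOf_of_convex
    ((h (-1) (-1)).2.inter ((h 1 (-1)).1.inter (h (-3) 1).1)) using 1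
  ext τ
  simp only [ellipticTriangle, circleForm, Set.mem_ofPred_eq, Set.mem_inter_iff]
  push_cast
  refine and_congr ?_ (and_congr ?_ ?_) <;> constructor <;> intro h <;> linarith

lemma IsPreconnected.pos_of_pos {X : Type*} [TopologicalSpace X] {S : Set X}
    (hS : IsPreconnected S) {h : X → ℝ} (hc : Continuous h) (h0 : ∀ x ∈ S, h x ≠ 0) {x y : X}
    (hx : x ∈ S) (hy : y ∈ S) (hpos : 0 < h x) : 0 < h y := by
  by_contra hneg
  obtain ⟨z, hz, hz0⟩ := hS.intermediate_value hy hx hc.continuousOn ⟨not_lt.1 hneg, hpos.le⟩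
  exact h0 z hz hz0

/-- `circleForm n τ = (Re τ - n)(Re τ - n - 1) + (Im τ)² - 1`, and for `n = ⌊Re τ⌋` the product is
at most 0. -/
lemma one_lt_im_of_mem_upperRegion {τ : ℍ} (h : τ ∈ upperRegion) : 1 < τ.im := by
  have h1 := h ⌊τ.re⌋
  have h2 := Int.floor_le τ.re
  have h3 := Int.lt_floor_add_one τ.re
  have h4 := τ.im_pos
  simp only [circleForm] at h1
  nlinarith [mul_nonneg (sub_nonneg.2 h2) (sub_nonneg.2 h3.le)]

/-- Differences of two of the three forms are linear in `Re τ`, which gives the strip; 1/2 is the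
height of the lowest vertex `(1 + i) / 2`. -/
lemma bounds_of_mem_ellipticTriangle {τ : ℍ} (h : τ ∈ ellipticTriangle) :
    0 < τ.re ∧ τ.re < 1 ∧ 1 / 2 < τ.im := by
  obtain ⟨h1, h2, h3⟩ := h
  simp only [circleForm] at h1 h2 h3
  push_cast at h1 h2 h3
  have h4 := τ.im_pos
  have hx : 0 < τ.re := by linarith
  have hx1 : τ.re < 1 := by linarith
  refine ⟨hx, hx1, ?_⟩
  rcases le_total τ.re (1 / 2) with h | h <;> nlinarith

/-- `circleForm n - circleForm m = (n - m)(n + m + 1 - 2 Re τ)`, which is nonnegative on the strip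
`m ≤ Re τ ≤ m + 1`: there the circle of index `m` dominates all others. -/
lemma mem_upperRegion_of_circleForm_pos {m : ℤ} {τ : ℍ} (h : 0 < circleForm m τ) (h1 : m ≤ τ.re)
    (h2 : τ.re ≤ m + 1) : τ ∈ upperRegion := by
  intro n
  simp only [circleForm] at h ⊢
  rcases lt_trichotomy n m with hn | rfl | hn
  · have : (n : ℝ) + 1 ≤ m := by exact_mod_cast hn
    nlinarith [mul_nonneg (show (0:ℝ) ≤ m - n by linarith)
      (show (0:ℝ) ≤ 2 * τ.re - (m + n + 1) by linarith)]
  · exact h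
  · have : (m : ℝ) + 1 ≤ n := by exact_mod_cast hn
    nlinarith [mul_nonneg (show (0:ℝ) ≤ n - m by linarith)
      (show (0:ℝ) ≤ (m + n + 1) - 2 * τ.re by linarith)]

lemma isOpen_upperRegion : IsOpen upperRegion := by
  rw [isOpen_iff_mem_nhds]
  intro τ hτ
  -- An open strip of width 2 around `τ`, on which only the circles `k` and `k + 1` matter; this
  -- reduces infinitely many conditions to two.
  obtain ⟨k, hk1, hk2⟩ : ∃ k : ℤ, (k : ℝ) < τ.re ∧ τ.re < k + 2 :=
    ⟨⌈τ.re⌉ - 1, by push_cast; linarith [Int.ceil_lt_add_one τ.re],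
      by push_cast; linarith [Int.le_ceil τ.re]⟩
  have hre := UpperHalfPlane.continuous_re
  filter_upwards [(isOpen_lt continuous_const hre).mem_nhds hk1,
    (isOpen_lt hre continuous_const).mem_nhds hk2,
    (isOpen_lt continuous_const (continuous_circleForm k)).mem_nhds (hτ k),
    (isOpen_lt continuous_const (continuous_circleForm (k + 1))).mem_nhds (hτ (k + 1))]
    with w h1 h2 h3 h4
  rcases le_total w.re (k + 1) with h | h
  · exact mem_upperRegion_of_circleForm_pos h3 h1.le h
  · exact mem_upperRegion_of_circleForm_pos h4 (by push_cast; exact h) (by push_cast; linarith)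

lemma isOpen_ellipticTriangle : IsOpen ellipticTriangle :=
  (isOpen_lt (continuous_circleForm 0) continuous_const).inter
    ((isOpen_lt continuous_const (continuous_circleForm (-1))).inter
      (isOpen_lt continuous_const (continuous_circleForm 1)))

lemma one_le_im_of_mem_closure_upperRegion {τ : ℍ} (h : τ ∈ closure upperRegion) : 1 ≤ τ.im :=
  closure_minimal (fun _ hw => (one_lt_im_of_mem_upperRegion hw).le)
    (isClosed_le continuous_const UpperHalfPlane.continuous_im) h

lemma bounds_of_mem_closure_ellipticTriangle {τ : ℍ} (h : τ ∈ closure ellipticTriangle) :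
    0 ≤ τ.re ∧ τ.re ≤ 1 ∧ 1 / 2 ≤ τ.im := by
  have hre := UpperHalfPlane.continuous_re
  refine closure_minimal (t := {w : ℍ | 0 ≤ w.re ∧ w.re ≤ 1 ∧ 1 / 2 ≤ w.im}) (fun w hw => ?_) ?_ h
  · obtain ⟨h1, h2, h3⟩ := bounds_of_mem_ellipticTriangle hw
    exact ⟨h1.le, h2.le, h3.le⟩
  · exact (isClosed_le continuous_const hre).inter ((isClosed_le hre continuous_const).inter
      (isClosed_le continuous_const UpperHalfPlane.continuous_im))

/-- On a geodesic of discriminant `5` that contains a point of height more than `1 / 2`, the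
leading coefficient of the form may be normalised to `1`. -/
lemma exists_circleForm_eq_zero {τ : ℍ} (hE : τ ∈ exceptionalSet 5) (him : 1 / 2 < τ.im) :
    ∃ n : ℤ, circleForm n τ = 0 := by
  obtain ⟨a, b, c, hd, hτ⟩ := hE
  rw [mem_formGeodesic_iff] at hτ
  have hdR : (b : ℝ) ^ 2 - 4 * a * c = 5 := by exact_mod_cast hd
  -- Completing the square; with `Im τ > 1/2` it yields `a² < 5`.
  have hcirc : (2 * a * τ.re + b) ^ 2 + 4 * (a : ℝ) ^ 2 * τ.im ^ 2 = 5 := by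
    linear_combination 4 * (a : ℝ) * hτ + hdR
  have ha : (a : ℝ) ^ 2 < 5 ∨ a = 0 := by
    by_cases ha : a = 0
    · exact Or.inr ha
    · left
      have ha' : 0 < (a : ℝ) ^ 2 := by positivity
      nlinarith [sq_nonneg (2 * a * τ.re + b)]
  have ha2 : a ^ 2 < 5 := by
    rcases ha with ha | rfl
    · exact_mod_cast ha
    · norm_num
  have hal : -3 < a := by nlinarith
  have hau : a < 3 := by nlinarith
  obtain ⟨k, hk⟩ : ∃ k, b = 2 * k + 1 := by
    rcases Int.even_or_odd' b with ⟨k, hk | hk⟩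
    · subst hk
      ring_nf at hd
      omega
    · exact ⟨k, hk⟩
  subst hk
  have hpar : ∃ j, k ^ 2 + k = 2 * j := by
    have := (Int.even_mul_succ_self k)
    obtain ⟨j, hj⟩ := this
    exact ⟨j, by linear_combination hj⟩
  obtain ⟨j, hj⟩ := hpar
  -- Thus `a c` is odd, which rules out `a = 0` and `a = ±2`.
  have hac : a * c = 2 * j - 1 := by nlinarith
  interval_cases a
  · omega
  · refine ⟨k, ?_⟩
    have hc : (c : ℝ) = -(k ^ 2 + k - 1) := by
      have : c = -(k ^ 2 + k - 1) := by linarith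
      rw [this]; push_cast; ring
    simp only [circleForm]
    push_cast at hτ
    linear_combination -hτ + hc
  · omega
  · refine ⟨-k - 1, ?_⟩
    have hc : (c : ℝ) = (k ^ 2 + k - 1) := by
      have : c = (k ^ 2 + k - 1) := by linarith
      rw [this]; push_cast; ring
    simp only [circleForm]
    push_cast at hτ ⊢
    linear_combination hτ - hc
  · omega

lemma upperRegion_subset_compl : upperRegion ⊆ (exceptionalSet 5)ᶜ := by
  intro τ hτ hE
  obtain ⟨n, hn⟩ := exists_circleForm_eq_zero hE (by linarith [one_lt_im_of_mem_upperRegion hτ])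
  exact (hτ n).ne' hn

lemma ellipticTriangle_subset_compl : ellipticTriangle ⊆ (exceptionalSet 5)ᶜ := by
  intro τ hτ hE
  obtain ⟨h1, h2, h3⟩ := bounds_of_mem_ellipticTriangle hτ
  obtain ⟨n, hn⟩ := exists_circleForm_eq_zero hE h3
  obtain ⟨ha, hb, hc⟩ := hτ
  have hn' := hn
  simp only [circleForm] at hn'
  -- The circle equation says that this square equals `5/4 - (Im τ)²`. With `0 < Re τ < 1` only `n =
  -- -1, 0, 1` remain, and these are the sides of the triangle.
  have hlt : (τ.re - (n + 1 / 2)) ^ 2 < 1 := by nlinarith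
  have hl : (-2 : ℤ) < n := by
    have : (-2 : ℝ) < n := by nlinarith
    exact_mod_cast this
  have hu : n < 2 := by
    have : (n : ℝ) < 2 := by nlinarith
    exact_mod_cast this
  interval_cases n <;> linarith

/-- The region is connected and avoids `E_5`; conversely no `circleForm n` vanishes off `E_5`, so
each keeps its sign along a component. -/
lemma connectedComponentIn_eq_upperRegion {τ : ℍ} (hτ : τ ∈ upperRegion) :
    connectedComponentIn (exceptionalSet 5)ᶜ τ = upperRegion := by
  refine Set.Subset.antisymm (fun w hw n => ?_)
    (isPreconnected_upperRegion.subset_connectedComponentIn hτ upperRegion_subset_compl)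
  exact isPreconnected_connectedComponentIn.pos_of_pos (continuous_circleForm n)
    (fun z hz h0 =>
      absurd (connectedComponentIn_subset _ _ hz)
        (not_not_intro (mem_exceptionalSet_of_circleForm_eq_zero h0)))
    (mem_connectedComponentIn (upperRegion_subset_compl hτ)) hw (hτ n)

lemma connectedComponentIn_eq_ellipticTriangle {τ : ℍ} (hτ : τ ∈ ellipticTriangle) :
    connectedComponentIn (exceptionalSet 5)ᶜ τ = ellipticTriangle := by
  refine Set.Subset.antisymm (fun w hw => ?_)
    (isPreconnected_ellipticTriangle.subset_connectedComponentIn hτ ellipticTriangle_subset_compl)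
  have hne : ∀ n, ∀ z ∈ connectedComponentIn (exceptionalSet 5)ᶜ τ, circleForm n z ≠ 0 :=
    fun n z hz h0 =>
      absurd (connectedComponentIn_subset _ _ hz)
        (not_not_intro (mem_exceptionalSet_of_circleForm_eq_zero h0))
  have hmem := mem_connectedComponentIn (ellipticTriangle_subset_compl hτ)
  refine ⟨?_, ?_, ?_⟩
  · have := isPreconnected_connectedComponentIn.pos_of_pos (continuous_circleForm 0).neg
      (fun z hz => neg_ne_zero.2 (hne 0 z hz)) hmem hw (neg_pos.2 hτ.1)
    exact neg_pos.1 this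
  · exact isPreconnected_connectedComponentIn.pos_of_pos (continuous_circleForm (-1))
      (hne _) hmem hw hτ.2.1
  · exact isPreconnected_connectedComponentIn.pos_of_pos (continuous_circleForm 1)
      (hne _) hmem hw hτ.2.2

/-! ### The modular group action -/

/-- The factor of automorphy `cτ + d`. -/
def autFactor (γ : SL(2, ℤ)) (τ : ℍ) : ℂ := (γ 1 0 : ℂ) * τ + (γ 1 1 : ℂ)

lemma autFactor_eq_denom (γ : SL(2, ℤ)) (τ : ℍ) :
    autFactor γ τ = UpperHalfPlane.denom γ τ := by
  simp [autFactor, UpperHalfPlane.denom]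

lemma autFactor_ne_zero (γ : SL(2, ℤ)) (τ : ℍ) : autFactor γ τ ≠ 0 :=
  autFactor_eq_denom γ τ ▸ UpperHalfPlane.denom_ne_zero _ τ

lemma coe_smul_mul_autFactor (γ : SL(2, ℤ)) (τ : ℍ) :
    ((γ • τ : ℍ) : ℂ) * autFactor γ τ = (γ 0 0 : ℂ) * τ + (γ 0 1 : ℂ) := by
  have h := autFactor_ne_zero γ τ
  rw [UpperHalfPlane.coe_specialLinearGroup_apply]
  simp only [autFactor, algebraMap_int_eq, eq_intCast, Complex.ofReal_intCast] at h ⊢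
  exact div_mul_cancel₀ _ h

lemma autFactor_mul (γ δ : SL(2, ℤ)) (τ : ℍ) :
    autFactor (γ * δ) τ = autFactor γ (δ • τ) * autFactor δ τ := by
  have h := coe_smul_mul_autFactor δ τ
  rw [autFactor, autFactor, add_mul, mul_assoc, h]
  simp only [autFactor, Matrix.SpecialLinearGroup.coe_mul, Matrix.mul_apply, Fin.sum_univ_two]
  push_cast
  ring

lemma autFactor_one (τ : ℍ) : autFactor 1 τ = 1 := by simp [autFactor]

lemma im_smul_mul_normSq_autFactor (γ : SL(2, ℤ)) (τ : ℍ) :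
    (γ • τ).im * Complex.normSq (autFactor γ τ) = τ.im := by
  rw [autFactor_eq_denom, ModularGroup.im_smul_eq_div_normSq, div_mul_cancel₀]
  exact UpperHalfPlane.normSq_denom_ne_zero _ τ.im_ne_zero

lemma det_entries (γ : SL(2, ℤ)) : γ 0 0 * γ 1 1 - γ 0 1 * γ 1 0 = 1 := by
  rw [← Matrix.det_fin_two, γ.det_coe]

lemma slash_neg_two_eq_iff (f : ℍ → ℂ) (γ : SL(2, ℤ)) :
    f ∣[(-2 : ℤ)] γ = f ↔ ∀ τ, autFactor γ τ ^ 2 * f (γ • τ) = f τ := by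
  rw [funext_iff]
  refine forall_congr' fun τ => ?_
  rw [ModularForm.SL_slash_apply, autFactor_eq_denom, mul_comm, neg_neg]
  norm_cast

lemma normSq_autFactor (γ : SL(2, ℤ)) (τ : ℍ) :
    Complex.normSq (autFactor γ τ) = (γ 1 0 * τ.re + γ 1 1) ^ 2 + (γ 1 0 * τ.im) ^ 2 := by
  simp [Complex.normSq_apply, autFactor]
  ring

instance continuousConstSMul_SL2Z : ContinuousConstSMul SL(2, ℤ) ℍ :=
  ⟨fun γ => continuous_const_smul (Matrix.SpecialLinearGroup.mapGL ℝ γ)⟩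

/-- If `γ • τ` lies on the geodesic of `Q`, then `τ` lies on that of `Q ∘ γ`, which has the same
discriminant; the two equations differ by the factor `|cτ + d|²`. -/
lemma smul_mem_exceptionalSet {D : ℤ} {γ : SL(2, ℤ)} {τ : ℍ} (h : γ • τ ∈ exceptionalSet D) :
    τ ∈ exceptionalSet D := by
  obtain ⟨a, b, c, hd, hz⟩ := h
  rw [mem_formGeodesic_iff] at hz
  have hdet := det_entries γ
  have hN := coe_smul_mul_autFactor γ τ
  generalize γ • τ = z at *
  have hre := congrArg Complex.re hN
  have him := congrArg Complex.im hN
  simp [autFactor] at hre him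
  generalize γ 0 0 = p at *
  generalize γ 0 1 = q at *
  generalize γ 1 0 = r at *
  generalize γ 1 1 = s at *
  refine ⟨a * p ^ 2 + b * p * r + c * r ^ 2, 2 * a * p * q + b * (p * s + q * r) + 2 * c * r * s,
    a * q ^ 2 + b * q * s + c * s ^ 2, ?_, ?_⟩
  · rw [← hd]
    linear_combination (b ^ 2 - 4 * a * c) * (p * s - q * r + 1) * hdet
  · rw [mem_formGeodesic_iff]
    push_cast
    have h1 : (p * τ.re + q : ℝ) = z.re * (r * τ.re + s) - z.im * (r * τ.im) := by
      linarith
    have h2 : (p * τ.im : ℝ) = z.re * (r * τ.im) + z.im * (r * τ.re + s) := by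
      linarith
    have h3 : ((a * p ^ 2 + b * p * r + c * r ^ 2 : ℝ) * (τ.re ^ 2 + τ.im ^ 2) +
        (2 * a * p * q + b * (p * s + q * r) + 2 * c * r * s) * τ.re +
        (a * q ^ 2 + b * q * s + c * s ^ 2)) =
        a * ((p * τ.re + q) ^ 2 + (p * τ.im) ^ 2) +
        b * ((p * τ.re + q) * (r * τ.re + s) + (p * τ.im) * (r * τ.im)) +
        c * ((r * τ.re + s) ^ 2 + (r * τ.im) ^ 2) := by ring
    rw [h3, h1, h2]
    linear_combination ((r * τ.re + s) ^ 2 + (r * τ.im) ^ 2) * hz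

lemma smul_mem_exceptionalSet_iff {D : ℤ} (γ : SL(2, ℤ)) (τ : ℍ) :
    γ • τ ∈ exceptionalSet D ↔ τ ∈ exceptionalSet D :=
  ⟨smul_mem_exceptionalSet, fun h => smul_mem_exceptionalSet (γ := γ⁻¹) (by rwa [inv_smul_smul])⟩

lemma connectedComponentIn_eq_preimage_smul {D : ℤ} (γ : SL(2, ℤ)) {τ : ℍ}
    (hτ : τ ∉ exceptionalSet D) : connectedComponentIn (exceptionalSet D)ᶜ τ =
      (γ • ·) ⁻¹' connectedComponentIn (exceptionalSet D)ᶜ (γ • τ) := by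
  have himg : Homeomorph.smul γ '' (exceptionalSet D)ᶜ = (exceptionalSet D)ᶜ := by
    ext w
    constructor
    · rintro ⟨z, hz, rfl⟩
      exact fun h => hz (smul_mem_exceptionalSet h)
    · intro hw
      exact ⟨γ⁻¹ • w, fun h => hw (smul_mem_exceptionalSet h), smul_inv_smul γ w⟩
  have h := (Homeomorph.smul γ).image_connectedComponentIn (x := τ)
    (show τ ∈ (exceptionalSet D)ᶜ from hτ)
  rw [himg] at h
  change _ = (Homeomorph.smul γ) ⁻¹' (connectedComponentIn (exceptionalSet D)ᶜ (Homeomorph.smul γ τ))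
  rw [← h, Homeomorph.preimage_image]

lemma preimage_smul_mem_complementComponents {D : ℤ} (γ : SL(2, ℤ)) {C : Set ℍ}
    (hC : C ∈ complementComponents (exceptionalSet D)) :
    (γ • ·) ⁻¹' C ∈ complementComponents (exceptionalSet D) := by
  obtain ⟨τ, hτ, rfl⟩ := hC
  have h : γ⁻¹ • τ ∉ exceptionalSet D := fun h => hτ (smul_mem_exceptionalSet h)
  exact ⟨γ⁻¹ • τ, h, by rw [connectedComponentIn_eq_preimage_smul γ h, smul_inv_smul]⟩

/-! ### Every orbit meets the closure of one of the two regions -/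

/-- A fundamental domain with vertices `i`, `i + 1`, `ρ` and `∞`. -/
lemma exists_smul_mem_fundamentalStrip (τ : ℍ) : ∃ γ : SL(2, ℤ), 0 ≤ (γ • τ).re ∧
    (γ • τ).re ≤ 1 ∧ 1 ≤ (γ • τ).re ^ 2 + (γ • τ).im ^ 2 ∧
    0 ≤ (γ • τ).re ^ 2 + (γ • τ).im ^ 2 - 2 * (γ • τ).re := by
  obtain ⟨γ, hγ⟩ := ModularGroup.exists_smul_mem_fd τ
  obtain ⟨h1, h2⟩ := hγ
  rw [← Complex.sq_norm, norm_coe_sq_eq] at h1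
  obtain ⟨h3, h4⟩ := abs_le.1 h2
  rcases le_total 0 (γ • τ).re with h | h
  · exact ⟨γ, h, by linarith, h1, by linarith⟩
  · refine ⟨ModularGroup.T * γ, ?_⟩
    rw [mul_smul, ModularGroup.re_T_smul, ModularGroup.im_T_smul]
    exact ⟨by linarith, by linarith, by nlinarith, by nlinarith⟩

lemma mem_upperRegion_or_mem_ellipticTriangle {τ : ℍ} (h0 : 0 ≤ τ.re) (h1 : τ.re ≤ 1)
    (h2 : 1 ≤ τ.re ^ 2 + τ.im ^ 2) (h3 : 0 ≤ τ.re ^ 2 + τ.im ^ 2 - 2 * τ.re) :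
    τ ∈ upperRegion ∨ τ ∈ ellipticTriangle ∨ circleForm 0 τ = 0 := by
  rcases lt_trichotomy (circleForm 0 τ) 0 with h | h | h
  · right; left
    refine ⟨h, ?_, ?_⟩ <;> simp only [circleForm] at h ⊢ <;> push_cast at h ⊢
    · by_contra! h'
      linarith
    · by_contra! h'
      linarith
  · exact Or.inr (Or.inr h)
  · exact Or.inl (mem_upperRegion_of_circleForm_pos h (by simpa using h0) (by simpa using h1))

lemma exists_smul_mem_of_notMem {τ : ℍ} (hτ : τ ∉ exceptionalSet 5) :
    ∃ γ : SL(2, ℤ), γ • τ ∈ upperRegion ∨ γ • τ ∈ ellipticTriangle := by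
  obtain ⟨γ, h0, h1, h2, h3⟩ := exists_smul_mem_fundamentalStrip τ
  refine ⟨γ, ?_⟩
  rcases mem_upperRegion_or_mem_ellipticTriangle h0 h1 h2 h3 with h | h | h
  · exact Or.inl h
  · exact Or.inr h
  · exact absurd (smul_mem_exceptionalSet (mem_exceptionalSet_of_circleForm_eq_zero h)) hτ

lemma exists_eq_preimage_of_mem_complementComponents {C : Set ℍ}
    (hC : C ∈ complementComponents (exceptionalSet 5)) :
    ∃ γ : SL(2, ℤ), C = (γ • ·) ⁻¹' upperRegion ∨ C = (γ • ·) ⁻¹' ellipticTriangle := by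
  obtain ⟨τ, hτ, rfl⟩ := hC
  obtain ⟨γ, h | h⟩ := exists_smul_mem_of_notMem hτ
  · exact ⟨γ, Or.inl (by
      rw [connectedComponentIn_eq_preimage_smul γ hτ, connectedComponentIn_eq_upperRegion h])⟩
  · exact ⟨γ, Or.inr (by
      rw [connectedComponentIn_eq_preimage_smul γ hτ, connectedComponentIn_eq_ellipticTriangle h])⟩

lemma circleForm_T_zpow_smul (m n : ℤ) (τ : ℍ) :
    circleForm n (ModularGroup.T ^ m • τ) = circleForm (n - m) τ := by
  simp only [circleForm, ModularGroup.re_T_zpow_smul, ModularGroup.im_T_zpow_smul]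
  push_cast
  ring

lemma T_zpow_smul_mem_upperRegion_iff (m : ℤ) (τ : ℍ) :
    ModularGroup.T ^ m • τ ∈ upperRegion ↔ τ ∈ upperRegion := by
  simp only [upperRegion, Set.mem_ofPred_eq, circleForm_T_zpow_smul]
  exact ⟨fun h n => by simpa using h (n + m), fun h n => h _⟩

lemma isOpen_of_mem_complementComponents {C : Set ℍ}
    (hC : C ∈ complementComponents (exceptionalSet 5)) : IsOpen C := by
  obtain ⟨γ, rfl | rfl⟩ := exists_eq_preimage_of_mem_complementComponents hC
  · exact isOpen_upperRegion.preimage (continuous_const_smul γ)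
  · exact isOpen_ellipticTriangle.preimage (continuous_const_smul γ)

/-! ### Overlaps of translates -/

/-- The polynomial `τ² - τ + 1` vanishing at `ρ`. -/
def rhoForm (z : ℂ) : ℂ := z ^ 2 - z + 1

lemma coe_rhoPoint : (rhoPoint : ℂ) = 1 / 2 + (Real.sqrt 3 / 2 : ℝ) * Complex.I := by
  have h : (Real.pi * Complex.I / 3 : ℂ) = ((Real.pi / 3 : ℝ) : ℂ) * Complex.I := by
    push_cast; ring
  change Complex.exp (Real.pi * Complex.I / 3) = _
  rw [h, Complex.exp_mul_I, ← Complex.ofReal_cos, ← Complex.ofReal_sin, Real.cos_pi_div_three,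
    Real.sin_pi_div_three]
  push_cast; ring

lemma rhoPoint_re : rhoPoint.re = 1 / 2 := by
  rw [← UpperHalfPlane.coe_re, coe_rhoPoint]; simp

lemma rhoPoint_im_sq : rhoPoint.im ^ 2 = 3 / 4 := by
  have : rhoPoint.im = Real.sqrt 3 / 2 := by
    rw [← UpperHalfPlane.coe_im, coe_rhoPoint]; simp
  rw [this, div_pow, Real.sq_sqrt (by norm_num)]
  norm_num

lemma rhoForm_rhoPoint : rhoForm rhoPoint = 0 := by
  have h : ((Real.sqrt 3 : ℝ) : ℂ) ^ 2 = 3 := by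
    norm_cast
    exact Real.sq_sqrt (by norm_num)
  rw [rhoForm, coe_rhoPoint]
  push_cast
  linear_combination Complex.I ^ 2 / 4 * h + 3 / 4 * Complex.I_sq

lemma rhoPoint_mem_ellipticTriangle : rhoPoint ∈ ellipticTriangle := by
  simp only [ellipticTriangle, circleForm, Set.mem_ofPred_eq, rhoPoint_re, rhoPoint_im_sq]
  norm_num

/-- Both heights exceed 1, which is impossible if `c ≠ 0`; so `c = 0` and `d = ±1`. -/
lemma autFactor_sq_eq_one_of_overlap {γ : SL(2, ℤ)} {τ : ℍ} (h1 : τ ∈ upperRegion)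
    (h2 : γ • τ ∈ upperRegion) : autFactor γ τ ^ 2 = 1 := by
  have i1 := one_lt_im_of_mem_upperRegion h1
  have i2 := one_lt_im_of_mem_upperRegion h2
  have h := im_smul_mul_normSq_autFactor γ τ
  rw [normSq_autFactor] at h
  have hc : γ 1 0 = 0 := by
    by_contra hc
    have hc1 : (1 : ℝ) ≤ (γ 1 0 : ℝ) ^ 2 := by
      have : 0 < (γ 1 0) ^ 2 := by positivity
      exact_mod_cast this
    have h3 : τ.im ^ 2 ≤ (γ 1 0 * τ.re + γ 1 1) ^ 2 + (γ 1 0 * τ.im) ^ 2 := by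
      nlinarith [sq_nonneg (γ 1 0 * τ.re + γ 1 1 : ℝ)]
    nlinarith
  have hdet := det_entries γ
  rw [hc, mul_zero, sub_zero] at hdet
  have hd : γ 1 1 ^ 2 = 1 := by
    have := Int.isUnit_iff.1 (IsUnit.of_mul_eq_one _ ((mul_comm _ _).trans hdet))
    rcases this with h | h <;> simp [h]
  simp only [autFactor, hc, Int.cast_zero, zero_mul, zero_add]
  exact_mod_cast hd

/-- Otherwise `γ` would carry the whole triangle into `upperRegion`, so `γ • ρ` would have height
above 1. But `|cρ + d|² = c² + cd + d² ≥ 1`, so the height of `ρ`, which is below 1, cannot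
increase. -/
lemma smul_notMem_upperRegion_of_mem_ellipticTriangle {γ : SL(2, ℤ)} {τ : ℍ}
    (h1 : τ ∈ ellipticTriangle) : γ • τ ∉ upperRegion := by
  intro h2
  have h := connectedComponentIn_eq_preimage_smul γ (ellipticTriangle_subset_compl h1)
  rw [connectedComponentIn_eq_ellipticTriangle h1, connectedComponentIn_eq_upperRegion h2] at h
  have h3 : γ • rhoPoint ∈ upperRegion := by
    have := rhoPoint_mem_ellipticTriangle
    rwa [h] at this
  have h4 := one_lt_im_of_mem_upperRegion h3
  have h5 := im_smul_mul_normSq_autFactor γ rhoPoint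
  have hI := rhoPoint_im_sq
  have hdet := det_entries γ
  have hn : 1 ≤ Complex.normSq (autFactor γ rhoPoint) := by
    rw [normSq_autFactor, mul_pow, hI, rhoPoint_re]
    have : 0 < (2 * γ 1 1 + γ 1 0) ^ 2 + 3 * (γ 1 0) ^ 2 := by
      by_contra! hle
      have hc : γ 1 0 = 0 := by nlinarith [sq_nonneg (2 * γ 1 1 + γ 1 0)]
      have hd : γ 1 1 = 0 := by rw [hc] at hle; nlinarith
      simp [hc, hd] at hdet
    have h4 : 1 ≤ (γ 1 1) ^ 2 + γ 1 1 * γ 1 0 + (γ 1 0) ^ 2 := by nlinarith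
    have h4' : (1 : ℝ) ≤ (γ 1 1) ^ 2 + γ 1 1 * γ 1 0 + (γ 1 0) ^ 2 := by exact_mod_cast h4
    linarith
  have hlt : rhoPoint.im < 1 := by nlinarith
  nlinarith

lemma form_eq_of_root_mem_ellipticTriangle {A B C : ℤ} (hA : 0 < A) (hD : 4 * A * C - B ^ 2 = 3)
    (h1 : 2 * C + B - 2 * A < 0) (h2 : 0 < 2 * C - B - 2 * A) (h3 : 0 < 2 * C + 3 * B + 2 * A) :
    A = 1 ∧ B = -1 ∧ C = 1 := by
  have hB : B < 0 := by linarith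
  have hB2 : B ^ 2 < 3 := by
    -- Combined with `4 (A + C)² = 4 (C - A)² + 4 (B² + 3)`, the two bounds give `4 B² < 12`.
    have : 4 * (C - A) ^ 2 < B ^ 2 := by nlinarith
    have : 9 * B ^ 2 < 4 * (A + C) ^ 2 := by nlinarith
    nlinarith
  have : B = -1 := by nlinarith
  subst this
  have : A = C := by omega
  subst this
  exact ⟨by nlinarith, rfl, by nlinarith⟩

/-- The left side is an integral form `[A, B, C]` of discriminant `-3` whose root `γ⁻¹ • ρ` lies in
the triangle, since `γ` preserves that component. The triangle inequalities at the root become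
linear in `A, B, C` and leave only `[1, -1, 1]`. -/
lemma rhoForm_smul_of_overlap {γ : SL(2, ℤ)} {τ : ℍ} (h1 : τ ∈ ellipticTriangle)
    (h2 : γ • τ ∈ ellipticTriangle) : autFactor γ τ ^ 2 * rhoForm (γ • τ : ℍ) = rhoForm τ := by
  have h := connectedComponentIn_eq_preimage_smul γ (ellipticTriangle_subset_compl h1)
  rw [connectedComponentIn_eq_ellipticTriangle h1, connectedComponentIn_eq_ellipticTriangle h2] at h
  have hz : γ⁻¹ • rhoPoint ∈ ellipticTriangle := by
    rw [h]
    simpa using rhoPoint_mem_ellipticTriangle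
  have key : ∀ w : ℍ, autFactor γ w ^ 2 * rhoForm (γ • w : ℍ) =
      ((γ 0 0 ^ 2 - γ 0 0 * γ 1 0 + γ 1 0 ^ 2 : ℤ) : ℂ) * w ^ 2 +
      ((2 * γ 0 0 * γ 0 1 - γ 0 0 * γ 1 1 - γ 0 1 * γ 1 0 + 2 * γ 1 0 * γ 1 1 : ℤ) : ℂ) * w +
      ((γ 0 1 ^ 2 - γ 0 1 * γ 1 1 + γ 1 1 ^ 2 : ℤ) : ℂ) := by
    intro w
    have hw := coe_smul_mul_autFactor γ w
    have : autFactor γ w ^ 2 * rhoForm (γ • w : ℍ) = (((γ • w : ℍ) : ℂ) * autFactor γ w) ^ 2 -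
        (((γ • w : ℍ) : ℂ) * autFactor γ w) * autFactor γ w + autFactor γ w ^ 2 := by
      rw [rhoForm]; ring
    rw [this, hw, autFactor]
    push_cast
    ring
  have hroot := key (γ⁻¹ • rhoPoint)
  rw [smul_inv_smul, rhoForm_rhoPoint, mul_zero] at hroot
  have hD : 4 * (γ 0 0 ^ 2 - γ 0 0 * γ 1 0 + γ 1 0 ^ 2) * (γ 0 1 ^ 2 - γ 0 1 * γ 1 1 + γ 1 1 ^ 2) -
      (2 * γ 0 0 * γ 0 1 - γ 0 0 * γ 1 1 - γ 0 1 * γ 1 0 + 2 * γ 1 0 * γ 1 1) ^ 2 = 3 := by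
    have hdet := det_entries γ
    linear_combination 3 * (γ 0 0 * γ 1 1 - γ 0 1 * γ 1 0 + 1) * hdet
  have hA0 : 0 ≤ γ 0 0 ^ 2 - γ 0 0 * γ 1 0 + γ 1 0 ^ 2 := by
    nlinarith [sq_nonneg (γ 0 0 - γ 1 0), sq_nonneg (γ 0 0), sq_nonneg (γ 1 0)]
  rw [key]
  generalize (γ 0 0 ^ 2 - γ 0 0 * γ 1 0 + γ 1 0 ^ 2) = A at *
  generalize (γ 0 1 ^ 2 - γ 0 1 * γ 1 1 + γ 1 1 ^ 2) = C at *
  generalize (2 * γ 0 0 * γ 0 1 - γ 0 0 * γ 1 1 - γ 0 1 * γ 1 0 + 2 * γ 1 0 * γ 1 1) = B at *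
  generalize γ⁻¹ • rhoPoint = z at *
  have hA : 0 < A := by
    rcases hA0.eq_or_lt with h | h
    · subst h
      nlinarith [sq_nonneg B]
    · exact h
  have hAR : (0 : ℝ) < A := by exact_mod_cast hA
  have hre := congrArg Complex.re hroot
  have him := congrArg Complex.im hroot
  simp [pow_two] at hre him
  have hy := z.im_pos
  have hB : (B : ℝ) = -2 * A * z.re := by
    have : z.im * (B + 2 * A * z.re) = 0 := by linarith
    rcases mul_eq_zero.1 this with h | h <;> linarith
  have hC : (C : ℝ) = A * (z.re ^ 2 + z.im ^ 2) := by
    rw [hB] at hre; linarith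
  obtain ⟨t1, t2, t3⟩ := hz
  simp only [circleForm] at t1 t2 t3
  push_cast at t1 t2 t3
  have s1 := mul_pos hAR (neg_pos.2 t1)
  have s2 := mul_pos hAR t2
  have s3 := mul_pos hAR t3
  obtain ⟨rfl, rfl, rfl⟩ := form_eq_of_root_mem_ellipticTriangle hA hD
    (by have : (2 * C + B - 2 * A : ℝ) < 0 := by rw [hB, hC]; linarith
        exact_mod_cast this)
    (by have : (0 : ℝ) < 2 * C - B - 2 * A := by rw [hB, hC]; linarith
        exact_mod_cast this)
    (by have : (0 : ℝ) < 2 * C + 3 * B + 2 * A := by rw [hB, hC]; linarith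
        exact_mod_cast this)
  rw [rhoForm]
  push_cast
  ring

/-! ### Averages over adjacent components -/

lemma mem_adjacentComponents_iff {E : Set ℍ} {τ : ℍ} {C : Set ℍ} :
    C ∈ adjacentComponents E τ ↔ C ∈ complementComponents E ∧ τ ∈ closure C := by
  rw [closure_eq_self_union_frontier]
  rfl

lemma subset_compl_of_mem_complementComponents {E C : Set ℍ} (hC : C ∈ complementComponents E) :
    C ⊆ Eᶜ := by
  obtain ⟨τ, -, rfl⟩ := hC
  exact connectedComponentIn_subset _ _

lemma HasAverageAt.congr {E : Set ℍ} {f g : ℍ → ℂ} {τ : ℍ} {a : ℂ} (h : HasAverageAt E f τ a)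
    (hfg : ∀ w ∉ E, f w = g w) : HasAverageAt E g τ a := by
  obtain ⟨S, L, hS, hne, hL, ha⟩ := h
  refine ⟨S, L, hS, hne, fun C hC => (hL C hC).congr' ?_, ha⟩
  have hC' : C ∈ adjacentComponents E τ := hS ▸ Finset.mem_coe.2 hC
  filter_upwards [self_mem_nhdsWithin] with w hw
  exact hfg w (subset_compl_of_mem_complementComponents hC'.1 hw)

/-- Adjacency means that `τ` is in the closure of `C`, so limits along `C` are unique. -/
lemma HasAverageAt.unique {E : Set ℍ} {f : ℍ → ℂ} {τ : ℍ} {a b : ℂ} (h : HasAverageAt E f τ a)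
    (h' : HasAverageAt E f τ b) : a = b := by
  obtain ⟨S, L, hS, -, hL, rfl⟩ := h
  obtain ⟨S', L', hS', -, hL', rfl⟩ := h'
  obtain rfl : S = S' := Finset.coe_injective (hS.trans hS'.symm)
  congr 1
  refine Finset.sum_congr rfl fun C hC => ?_
  have hC' : C ∈ adjacentComponents E τ := hS ▸ Finset.mem_coe.2 hC
  have := mem_closure_iff_nhdsWithin_neBot.1 (mem_adjacentComponents_iff.1 hC').2
  exact tendsto_nhds_unique (hL C hC) (hL' C hC)

lemma HasAverageAt.add {E : Set ℍ} {f g : ℍ → ℂ} {τ : ℍ} {a b : ℂ} (h : HasAverageAt E f τ a)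
    (h' : HasAverageAt E g τ b) : HasAverageAt E (f + g) τ (a + b) := by
  obtain ⟨S, L, hS, hne, hL, rfl⟩ := h
  obtain ⟨S', L', hS', -, hL', rfl⟩ := h'
  obtain rfl : S = S' := Finset.coe_injective (hS.trans hS'.symm)
  refine ⟨S, L + L', hS, hne, fun C hC => (hL C hC).add (hL' C hC), ?_⟩
  simp only [Pi.add_apply, Finset.sum_add_distrib, mul_add]

lemma HasAverageAt.smul {E : Set ℍ} {f : ℍ → ℂ} {τ : ℍ} {a : ℂ} (c : ℂ)
    (h : HasAverageAt E f τ a) : HasAverageAt E (c • f) τ (c • a) := by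
  obtain ⟨S, L, hS, hne, hL, rfl⟩ := h
  refine ⟨S, c • L, hS, hne, fun C hC => (hL C hC).const_smul c, ?_⟩
  simp only [Pi.smul_apply, smul_eq_mul, ← Finset.mul_sum]
  ring

lemma exists_hasAverageAt {E : Set ℍ} {f : ℍ → ℂ} {τ : ℍ} (hf : IsLocalPolynomial E f)
    (hfin : (adjacentComponents E τ).Finite) (hne : (adjacentComponents E τ).Nonempty) :
    ∃ a, HasAverageAt E f τ a := by
  have hlim : ∀ C ∈ adjacentComponents E τ, ∃ l, Tendsto f (𝓝[C] τ) (𝓝 l) := by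
    intro C hC
    obtain ⟨P, hP⟩ := hf C hC.1
    refine ⟨P.eval (τ : ℂ), Tendsto.congr' (f₁ := fun w : ℍ => P.eval (w : ℂ)) ?_ ?_⟩
    · filter_upwards [self_mem_nhdsWithin] with w hw using (hP w hw).symm
    · exact ((P.continuous.comp UpperHalfPlane.continuous_coe).tendsto τ).mono_left
        nhdsWithin_le_nhds
  choose! L hL using hlim
  exact ⟨_, hfin.toFinset, L, hfin.coe_toFinset, (hfin.toFinset_nonempty).2 hne,
    fun C hC => hL C (hfin.mem_toFinset.1 hC), rfl⟩

lemma preimage_smul_mem_adjacentComponents {D : ℤ} (γ : SL(2, ℤ)) {τ : ℍ} {C : Set ℍ}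
    (hC : C ∈ adjacentComponents (exceptionalSet D) (γ • τ)) :
    (γ • ·) ⁻¹' C ∈ adjacentComponents (exceptionalSet D) τ := by
  rw [mem_adjacentComponents_iff] at hC ⊢
  refine ⟨preimage_smul_mem_complementComponents γ hC.1, ?_⟩
  have := (Homeomorph.smul γ).preimage_closure C
  change τ ∈ closure ((Homeomorph.smul γ) ⁻¹' C)
  rw [← this]
  exact hC.2

lemma preimage_smul_preimage_inv_smul (γ : SL(2, ℤ)) (C : Set ℍ) :
    ((γ • ·) ⁻¹' ((γ⁻¹ • ·) ⁻¹' C) : Set ℍ) = C := by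
  ext w
  simp

lemma image_preimage_smul_adjacentComponents {D : ℤ} (γ : SL(2, ℤ)) (τ : ℍ) :
    (fun C : Set ℍ => (γ • ·) ⁻¹' C) '' adjacentComponents (exceptionalSet D) (γ • τ) =
      adjacentComponents (exceptionalSet D) τ := by
  refine Set.Subset.antisymm ?_ fun C hC => ?_
  · rintro _ ⟨C, hC, rfl⟩
    exact preimage_smul_mem_adjacentComponents γ hC
  · exact ⟨(γ⁻¹ • ·) ⁻¹' C, preimage_smul_mem_adjacentComponents γ⁻¹ (by rwa [inv_smul_smul]),
      preimage_smul_preimage_inv_smul γ C⟩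

lemma continuous_autFactor (γ : SL(2, ℤ)) : Continuous (autFactor γ) := by
  have := UpperHalfPlane.continuous_coe
  unfold autFactor
  fun_prop

-- The action of `γ` is a homeomorphism matching the components adjacent to `τ` with those adjacent
-- to `γ • τ`, and the limits scale by the continuous factor.
open Classical in
lemma HasAverageAt.of_smul {D : ℤ} {f : ℍ → ℂ} {γ : SL(2, ℤ)} {τ : ℍ} {a : ℂ}
    (hf : ∀ w, autFactor γ w ^ 2 * f (γ • w) = f w)
    (h : HasAverageAt (exceptionalSet D) f (γ • τ) a) :
    HasAverageAt (exceptionalSet D) f τ (autFactor γ τ ^ 2 * a) := by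
  obtain ⟨S, L, hS, hne, hL, rfl⟩ := h
  have hinj : Function.Injective fun C : Set ℍ => ((γ • ·) ⁻¹' C : Set ℍ) :=
    (MulAction.surjective γ).preimage_injective
  refine ⟨S.image fun C => (γ • ·) ⁻¹' C,
    fun C => autFactor γ τ ^ 2 * L ((γ⁻¹ • ·) ⁻¹' C), ?_, hne.image _, ?_, ?_⟩
  · rw [Finset.coe_image, hS, image_preimage_smul_adjacentComponents]
  · intro C' hC'
    obtain ⟨C, hC, rfl⟩ := Finset.mem_image.1 hC'
    have hinv : ((γ⁻¹ • ·) ⁻¹' ((γ • ·) ⁻¹' C) : Set ℍ) = C := by ext w; simp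
    simp only [hinv]
    have h1 : Tendsto (fun w : ℍ => γ • w) (𝓝[(γ • ·) ⁻¹' C] τ) (𝓝[C] (γ • τ)) :=
      tendsto_nhdsWithin_of_tendsto_nhds_of_eventually_within _
        (((continuous_const_smul γ).tendsto τ).mono_left nhdsWithin_le_nhds)
        self_mem_nhdsWithin
    have h2 : Tendsto (fun w => autFactor γ w ^ 2) (𝓝[(γ • ·) ⁻¹' C] τ)
        (𝓝 (autFactor γ τ ^ 2)) :=
      (((continuous_autFactor γ).pow 2).tendsto τ).mono_left nhdsWithin_le_nhds
    exact (h2.mul ((hL C hC).comp h1)).congr hf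
  · rw [Finset.card_image_of_injective _ hinj, Finset.sum_image hinj.injOn]
    have hinv : ∀ C : Set ℍ, ((γ⁻¹ • ·) ⁻¹' ((γ • ·) ⁻¹' C) : Set ℍ) = C := by
      intro C; ext w; simp
    simp only [hinv, ← Finset.mul_sum]
    ring

/-! ### Local finiteness -/

lemma finite_setOf_lattice_le (τ : ℍ) (M : ℝ) :
    {v : ℤ × ℤ | (v.1 * τ.re + v.2) ^ 2 + (v.1 * τ.im) ^ 2 ≤ M}.Finite := by
  have hy := τ.im_pos
  obtain ⟨K, hK⟩ := exists_nat_ge (M / τ.im ^ 2 + 1)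
  obtain ⟨N, hN⟩ := exists_nat_ge (M + 1 + K * |τ.re|)
  refine ((Set.finite_Icc (-(K : ℤ)) K).prod (Set.finite_Icc (-(N : ℤ)) N)).subset ?_
  rintro ⟨c, d⟩ h
  simp only [Set.mem_ofPred_eq] at h
  have hc2 : (c : ℝ) ^ 2 ≤ M / τ.im ^ 2 := by
    rw [le_div_iff₀ (by positivity)]
    nlinarith [sq_nonneg (c * τ.re + d : ℝ)]
  have hc : |(c : ℝ)| ≤ K := by
    refine le_trans ?_ hK
    have := sq_abs (c : ℝ)
    nlinarith [sq_nonneg (|(c : ℝ)| - 1)]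
  have hcd : |(c * τ.re + d : ℝ)| ≤ M + 1 := by
    have := sq_abs (c * τ.re + d : ℝ)
    nlinarith [sq_nonneg (|(c * τ.re + d : ℝ)| - 1), sq_nonneg (c * τ.im : ℝ)]
  have hd : |(d : ℝ)| ≤ N := by
    refine le_trans ?_ hN
    have h1 : |(d : ℝ)| ≤ |(c * τ.re + d : ℝ)| + |(c : ℝ) * τ.re| := by
      have := abs_sub (c * τ.re + d : ℝ) (c * τ.re)
      rwa [add_sub_cancel_left] at this
    rw [abs_mul] at h1
    nlinarith [abs_nonneg τ.re]
  rw [abs_le] at hc hd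
  refine ⟨⟨?_, ?_⟩, ⟨?_, ?_⟩⟩
  · exact_mod_cast hc.1
  · exact_mod_cast hc.2
  · exact_mod_cast hd.1
  · exact_mod_cast hd.2

/-- The height bound confines `(c, d)` through `|cτ + d|² = Im τ / Im (γ • τ)`; then `|aτ + b|² = |γ
• τ|² |cτ + d|²` confines `(a, b)`. -/
lemma finite_setOf_smul_mem_strip (τ : ℍ) :
    {γ : SL(2, ℤ) | 0 ≤ (γ • τ).re ∧ (γ • τ).re ≤ 1 ∧ 1 / 2 ≤ (γ • τ).im}.Finite := by
  have hy := τ.im_pos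
  -- A lower bound for `|cτ + d|²`: the cases `c = 0` and `c ≠ 0` give 1 and `(Im τ)²`. It caps the
  -- height of `γ • τ`.
  set m := min 1 (τ.im ^ 2) with hm
  have hm0 : 0 < m := by positivity
  have hfin := (finite_setOf_lattice_le τ (2 * τ.im + τ.im ^ 2 / m)).prod
    (finite_setOf_lattice_le τ (2 * τ.im))
  refine Set.Finite.of_finite_image (f := fun γ : SL(2, ℤ) => ((γ 0 0, γ 0 1), (γ 1 0, γ 1 1)))
    (hfin.subset ?_) ?_
  · rintro _ ⟨γ, ⟨h0, h1, h2⟩, rfl⟩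
    have him := im_smul_mul_normSq_autFactor γ τ
    have hdet := det_entries γ
    have hN := congrArg Complex.normSq (coe_smul_mul_autFactor γ τ)
    rw [map_mul, Complex.normSq_apply ((γ • τ : ℍ) : ℂ), UpperHalfPlane.coe_re,
      UpperHalfPlane.coe_im] at hN
    have hnum : Complex.normSq ((γ 0 0 : ℂ) * τ + (γ 0 1 : ℂ)) =
        (γ 0 0 * τ.re + γ 0 1) ^ 2 + (γ 0 0 * τ.im) ^ 2 := by
      simp [Complex.normSq_apply]
      ring
    have hn := normSq_autFactor γ τ
    have hnm : m ≤ Complex.normSq (autFactor γ τ) := by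
      rw [hn]
      by_cases hc : γ 1 0 = 0
      · have hd : γ 1 1 ≠ 0 := by
          intro hd
          simp [hc, hd] at hdet
        have hd1 : (1 : ℝ) ≤ (γ 1 1 : ℝ) ^ 2 := by
          have : 0 < γ 1 1 ^ 2 := by positivity
          exact_mod_cast this
        rw [hc, Int.cast_zero, zero_mul, zero_mul, zero_add, zero_pow two_ne_zero, add_zero]
        exact (min_le_left _ _).trans hd1
      · have hc1 : (1 : ℝ) ≤ (γ 1 0 : ℝ) ^ 2 := by
          have : 0 < γ 1 0 ^ 2 := by positivity
          exact_mod_cast this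
        have := min_le_right 1 (τ.im ^ 2)
        nlinarith [sq_nonneg (γ 1 0 * τ.re + γ 1 1 : ℝ), sq_nonneg τ.im]
    have hn2 : Complex.normSq (autFactor γ τ) ≤ 2 * τ.im := by nlinarith
    have hY : (γ • τ).im ≤ τ.im / m := by
      rw [le_div_iff₀ hm0]
      nlinarith
    refine ⟨?_, ?_⟩
    · simp only [Set.mem_ofPred_eq]
      rw [← hnum, ← hN]
      have e : τ.im ^ 2 / m = τ.im * (τ.im / m) := by ring
      have hX : (γ • τ).re * (γ • τ).re ≤ 1 := by nlinarith
      rw [e]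
      nlinarith [mul_le_mul_of_nonneg_left hY hy.le]
    · simp only [Set.mem_ofPred_eq]
      rw [← hn]
      exact hn2
  · intro γ _ δ _ h
    simp only [Prod.mk.injEq] at h
    ext i j
    fin_cases i <;> fin_cases j
    exacts [h.1.1, h.1.2, h.2.1, h.2.2]

lemma finite_adjacentComponents (τ : ℍ) : (adjacentComponents (exceptionalSet 5) τ).Finite := by
  have hfin := finite_setOf_smul_mem_strip τ
  refine ((hfin.image fun γ => ((γ • ·) ⁻¹' upperRegion : Set ℍ)).union
    (hfin.image fun γ => ((γ • ·) ⁻¹' ellipticTriangle : Set ℍ))).subset ?_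
  intro C hC
  rw [mem_adjacentComponents_iff] at hC
  obtain ⟨hC, hτ⟩ := hC
  obtain ⟨γ, rfl | rfl⟩ := exists_eq_preimage_of_mem_complementComponents hC
  · left
    have h1 : γ • τ ∈ closure upperRegion :=
      (continuous_const_smul γ).closure_preimage_subset _ hτ
    -- `upperRegion` is invariant under translation, so `γ` may be changed to bring `τ` into the
    -- strip without changing the component.
    refine ⟨ModularGroup.T ^ (-⌊(γ • τ).re⌋) * γ, ?_, ?_⟩
    · simp only [Set.mem_ofPred_eq, mul_smul, ModularGroup.re_T_zpow_smul,
        ModularGroup.im_T_zpow_smul]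
      push_cast
      refine ⟨by linarith [Int.floor_le (γ • τ).re], by linarith [Int.lt_floor_add_one (γ • τ).re],
        by linarith [one_le_im_of_mem_closure_upperRegion h1]⟩
    · ext w
      simp only [Set.mem_preimage, mul_smul, T_zpow_smul_mem_upperRegion_iff]
  · right
    have h1 : γ • τ ∈ closure ellipticTriangle :=
      (continuous_const_smul γ).closure_preimage_subset _ hτ
    exact ⟨γ, bounds_of_mem_closure_ellipticTriangle h1, rfl⟩

lemma mem_closure_upperRegion_of_circleForm_eq_zero {τ : ℍ} (h0 : 0 ≤ τ.re) (h1 : τ.re ≤ 1)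
    (h : circleForm 0 τ = 0) : τ ∈ closure upperRegion := by
  -- The point is approached vertically from above, where `circleForm 0` is positive.
  obtain ⟨e, he0, he⟩ : ∃ e : ℕ → ℝ, (∀ n, 0 < e n) ∧ Tendsto e atTop (𝓝 0) :=
    ⟨_, fun _ => Nat.one_div_pos_of_nat, tendsto_one_div_add_atTop_nhds_zero_nat⟩
  have him : ∀ n, ((τ : ℂ) + e n * Complex.I).im = τ.im + e n := fun n => by simp
  have hpos : ∀ n, 0 < ((τ : ℂ) + e n * Complex.I).im := fun n => by
    rw [him]
    exact add_pos τ.im_pos (he0 n)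
  have hu : Tendsto (fun n => (⟨_, hpos n⟩ : ℍ)) atTop (𝓝 τ) := by
    rw [UpperHalfPlane.isEmbedding_coe.tendsto_nhds_iff]
    have h2 : Tendsto (fun n => (e n : ℂ)) atTop (𝓝 ((0 : ℝ) : ℂ)) :=
      (Complex.continuous_ofReal.tendsto _).comp he
    have h3 := (h2.mul_const Complex.I).const_add (τ : ℂ)
    rwa [Complex.ofReal_zero, zero_mul, add_zero] at h3
  refine mem_closure_of_tendsto hu (Eventually.of_forall fun n => ?_)
  have hre : (⟨_, hpos n⟩ : ℍ).re = τ.re := by simp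
  refine mem_upperRegion_of_circleForm_pos (m := 0) ?_ (by rw [hre]; exact_mod_cast h0)
    (by rw [hre]; simpa using h1)
  simp only [circleForm, hre, UpperHalfPlane.mk_im, him] at h ⊢
  nlinarith [mul_pos τ.im_pos (he0 n), mul_pos (he0 n) (he0 n)]

lemma preimage_upperRegion_mem_complementComponents (γ : SL(2, ℤ)) :
    (γ • ·) ⁻¹' upperRegion ∈ complementComponents (exceptionalSet 5) := by
  have h : (2 * Complex.I).im > 0 := by simp
  have hmem : (⟨2 * Complex.I, h⟩ : ℍ) ∈ upperRegion :=
    mem_upperRegion_of_circleForm_pos (m := 0) (by simp [circleForm]) (by simp) (by simp)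
  exact preimage_smul_mem_complementComponents γ
    ⟨_, upperRegion_subset_compl hmem, (connectedComponentIn_eq_upperRegion hmem).symm⟩

lemma preimage_ellipticTriangle_mem_complementComponents (γ : SL(2, ℤ)) :
    (γ • ·) ⁻¹' ellipticTriangle ∈ complementComponents (exceptionalSet 5) :=
  preimage_smul_mem_complementComponents γ
    ⟨_, ellipticTriangle_subset_compl rhoPoint_mem_ellipticTriangle,
      (connectedComponentIn_eq_ellipticTriangle rhoPoint_mem_ellipticTriangle).symm⟩

lemma nonempty_adjacentComponents (τ : ℍ) :
    (adjacentComponents (exceptionalSet 5) τ).Nonempty := by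
  obtain ⟨γ, h0, h1, h2, h3⟩ := exists_smul_mem_fundamentalStrip τ
  have key : γ • τ ∈ closure upperRegion ∨ γ • τ ∈ closure ellipticTriangle := by
    rcases mem_upperRegion_or_mem_ellipticTriangle h0 h1 h2 h3 with h | h | h
    · exact Or.inl (subset_closure h)
    · exact Or.inr (subset_closure h)
    · exact Or.inl (mem_closure_upperRegion_of_circleForm_eq_zero h0 h1 h)
  have hU := preimage_upperRegion_mem_complementComponents 1
  have hT := preimage_ellipticTriangle_mem_complementComponents 1
  simp only [one_smul, Set.preimage_id'] at hU hT
  rcases key with h | h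
  · exact ⟨_, preimage_smul_mem_adjacentComponents γ (mem_adjacentComponents_iff.2 ⟨hU, h⟩)⟩
  · exact ⟨_, preimage_smul_mem_adjacentComponents γ (mem_adjacentComponents_iff.2 ⟨hT, h⟩)⟩

/-- Components are open, so one with `τ` in its closure meets, hence equals, the component of `τ`.
-/
lemma adjacentComponents_eq_singleton {τ : ℍ} (hτ : τ ∉ exceptionalSet 5) :
    adjacentComponents (exceptionalSet 5) τ =
      {connectedComponentIn (exceptionalSet 5)ᶜ τ} := by
  have hmem : τ ∈ connectedComponentIn (exceptionalSet 5)ᶜ τ := mem_connectedComponentIn hτ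
  have hcomp : connectedComponentIn (exceptionalSet 5)ᶜ τ ∈
    complementComponents (exceptionalSet 5) := ⟨τ, hτ, rfl⟩
  refine Set.Subset.antisymm (fun C hC => ?_) ?_
  · rw [mem_adjacentComponents_iff] at hC
    obtain ⟨⟨σ, hσ, rfl⟩, hcl⟩ := hC
    obtain ⟨w, hw, hw'⟩ := mem_closure_iff.1 hcl _ (isOpen_of_mem_complementComponents hcomp) hmem
    rw [Set.mem_singleton_iff, connectedComponentIn_eq hw, connectedComponentIn_eq hw']
  · rintro _ rfl
    exact mem_adjacentComponents_iff.2 ⟨hcomp, subset_closure hmem⟩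

lemma hasAverageAt_self {f : ℍ → ℂ} (hf : IsLocalPolynomial (exceptionalSet 5) f) {τ : ℍ}
    (hτ : τ ∉ exceptionalSet 5) : HasAverageAt (exceptionalSet 5) f τ (f τ) := by
  have hcomp : connectedComponentIn (exceptionalSet 5)ᶜ τ ∈
    complementComponents (exceptionalSet 5) := ⟨τ, hτ, rfl⟩
  obtain ⟨P, hP⟩ := hf _ hcomp
  refine ⟨{connectedComponentIn (exceptionalSet 5)ᶜ τ}, fun _ => f τ, ?_,
    Finset.singleton_nonempty _, ?_, by simp⟩
  · rw [adjacentComponents_eq_singleton hτ, Finset.coe_singleton]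
  · intro C hC
    obtain rfl := Finset.mem_singleton.1 hC
    rw [hP τ (mem_connectedComponentIn hτ)]
    refine Tendsto.congr' (f₁ := fun w : ℍ => P.eval (w : ℂ)) ?_ ?_
    · filter_upwards [self_mem_nhdsWithin] with w hw using (hP w hw).symm
    · exact ((P.continuous.comp UpperHalfPlane.continuous_coe).tendsto τ).mono_left
        nhdsWithin_le_nhds

/-- A weight `-2` invariant local polynomial can be corrected on the exceptional set so as to
satisfy the average condition. -/
lemma exists_isModularLocalPolynomial {g : ℍ → ℂ}
    (hg : ∀ (γ : SL(2, ℤ)) τ, autFactor γ τ ^ 2 * g (γ • τ) = g τ)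
    (hloc : IsLocalPolynomial (exceptionalSet 5) g) :
    ∃ f, IsModularLocalPolynomial (-2) (exceptionalSet 5) f ∧
      ∀ τ ∉ exceptionalSet 5, f τ = g τ := by
  choose f hf using fun τ : ℍ =>
    exists_hasAverageAt hloc (finite_adjacentComponents τ) (nonempty_adjacentComponents τ)
  have hfg : ∀ τ ∉ exceptionalSet 5, f τ = g τ := fun τ hτ =>
    (hf τ).unique (hasAverageAt_self hloc hτ)
  refine ⟨f, ⟨fun γ => ?_, fun C hC => ?_, fun τ => ?_⟩, hfg⟩
  · rw [slash_neg_two_eq_iff]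
    exact fun τ => ((hf (γ • τ)).of_smul (hg γ)).unique (hf τ)
  · obtain ⟨P, hP⟩ := hloc C hC
    exact ⟨P, fun τ hτ => by
      rw [hfg τ (subset_compl_of_mem_complementComponents hC hτ), hP τ hτ]⟩
  · exact (hf τ).congr fun w hw => (hfg w hw).symm

/-! ### Construction -/

open Classical in
/-- The weight `-2` invariant function equal to `α` on the upper region, to `β (τ² - τ + 1)` on the
elliptic triangle, and to `0` on the exceptional set. -/
noncomputable def orbitExtension (α β : ℂ) (τ : ℍ) : ℂ :=
  if h : ∃ γ : SL(2, ℤ), γ • τ ∈ upperRegion then α * autFactor h.choose τ ^ 2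
  else if h : ∃ γ : SL(2, ℤ), γ • τ ∈ ellipticTriangle then
    β * (autFactor h.choose τ ^ 2 * rhoForm (h.choose • τ : ℍ))
  else 0

lemma autFactor_mul_inv (γ δ : SL(2, ℤ)) (τ : ℍ) :
    autFactor γ τ = autFactor (γ * δ⁻¹) (δ • τ) * autFactor δ τ := by
  rw [← autFactor_mul, inv_mul_cancel_right]

lemma mul_inv_smul_smul (γ δ : SL(2, ℤ)) (τ : ℍ) : (γ * δ⁻¹) • δ • τ = γ • τ := by
  rw [smul_smul, inv_mul_cancel_right]

/-- Independence of the chosen group element: two choices differ by a self-overlap of the region. -/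
lemma orbitExtension_of_upperRegion (α β : ℂ) {γ : SL(2, ℤ)} {τ : ℍ} (h : γ • τ ∈ upperRegion) :
    orbitExtension α β τ = α * autFactor γ τ ^ 2 := by
  have hex : ∃ γ : SL(2, ℤ), γ • τ ∈ upperRegion := ⟨γ, h⟩
  rw [orbitExtension, dif_pos hex]
  have hδ := hex.choose_spec
  generalize hex.choose = δ at hδ ⊢
  rw [autFactor_mul_inv γ δ τ, mul_pow,
    autFactor_sq_eq_one_of_overlap hδ (by rwa [mul_inv_smul_smul]), one_mul]

lemma orbitExtension_of_ellipticTriangle (α β : ℂ) {γ : SL(2, ℤ)} {τ : ℍ}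
    (h : γ • τ ∈ ellipticTriangle) :
    orbitExtension α β τ = β * (autFactor γ τ ^ 2 * rhoForm (γ • τ : ℍ)) := by
  have hex : ∃ γ : SL(2, ℤ), γ • τ ∈ ellipticTriangle := ⟨γ, h⟩
  have hnot : ¬ ∃ γ : SL(2, ℤ), γ • τ ∈ upperRegion := by
    rintro ⟨δ, hδ⟩
    exact smul_notMem_upperRegion_of_mem_ellipticTriangle (γ := δ * γ⁻¹) h
      (by rwa [mul_inv_smul_smul])
  rw [orbitExtension, dif_neg hnot, dif_pos hex]
  have hδ := hex.choose_spec
  generalize hex.choose = δ at hδ ⊢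
  have key := rhoForm_smul_of_overlap (γ := γ * δ⁻¹) hδ (by rwa [mul_inv_smul_smul])
  rw [mul_inv_smul_smul] at key
  rw [autFactor_mul_inv γ δ τ, ← key]
  ring

lemma orbitExtension_smul (α β : ℂ) (γ : SL(2, ℤ)) (τ : ℍ) :
    autFactor γ τ ^ 2 * orbitExtension α β (γ • τ) = orbitExtension α β τ := by
  by_cases hτ : τ ∈ exceptionalSet 5
  · have h0 : ∀ w ∈ exceptionalSet 5, orbitExtension α β w = 0 := by
      intro w hw
      rw [orbitExtension, dif_neg, dif_neg]
      · rintro ⟨δ, hδ⟩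
        exact ellipticTriangle_subset_compl hδ ((smul_mem_exceptionalSet_iff δ w).2 hw)
      · rintro ⟨δ, hδ⟩
        exact upperRegion_subset_compl hδ ((smul_mem_exceptionalSet_iff δ w).2 hw)
    rw [h0 τ hτ, h0 _ ((smul_mem_exceptionalSet_iff γ τ).2 hτ), mul_zero]
  · obtain ⟨δ, h | h⟩ := exists_smul_mem_of_notMem hτ
    · rw [orbitExtension_of_upperRegion α β h, orbitExtension_of_upperRegion α β
        (γ := δ * γ⁻¹) (by rwa [mul_inv_smul_smul]), autFactor_mul_inv δ γ τ]
      ring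
    · rw [orbitExtension_of_ellipticTriangle α β h, orbitExtension_of_ellipticTriangle α β
        (γ := δ * γ⁻¹) (by rwa [mul_inv_smul_smul]), mul_inv_smul_smul, autFactor_mul_inv δ γ τ]
      ring

lemma isLocalPolynomial_orbitExtension (α β : ℂ) :
    IsLocalPolynomial (exceptionalSet 5) (orbitExtension α β) := by
  intro C hC
  obtain ⟨γ, rfl | rfl⟩ := exists_eq_preimage_of_mem_complementComponents hC
  · refine ⟨.C α * (.C (γ 1 0 : ℂ) * .X + .C (γ 1 1 : ℂ)) ^ 2, fun τ hτ => ?_⟩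
    rw [orbitExtension_of_upperRegion α β hτ]
    simp [autFactor]
  · refine ⟨.C β * ((.C (γ 0 0 : ℂ) * .X + .C (γ 0 1 : ℂ)) ^ 2 -
      (.C (γ 0 0 : ℂ) * .X + .C (γ 0 1 : ℂ)) * (.C (γ 1 0 : ℂ) * .X + .C (γ 1 1 : ℂ)) +
      (.C (γ 1 0 : ℂ) * .X + .C (γ 1 1 : ℂ)) ^ 2), fun τ hτ => ?_⟩
    rw [orbitExtension_of_ellipticTriangle α β hτ]
    have hN := coe_smul_mul_autFactor γ τ
    simp only [Polynomial.eval_mul, Polynomial.eval_C, Polynomial.eval_add, Polynomial.eval_sub,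
      Polynomial.eval_pow, Polynomial.eval_X]
    rw [← hN, rhoForm, ← autFactor]
    ring

lemma exists_modularLocalPolynomial_eq (α β : ℂ) :
    ∃ f ∈ modularLocalPolynomials (-2) 5, (∀ τ ∈ upperRegion, f τ = α) ∧
      ∀ τ ∈ ellipticTriangle, f τ = β * ((τ : ℂ) ^ 2 - (τ : ℂ) + 1) := by
  obtain ⟨f, hf, hfg⟩ := exists_isModularLocalPolynomial (orbitExtension_smul α β)
    (isLocalPolynomial_orbitExtension α β)
  refine ⟨f, hf, fun τ hτ => ?_, fun τ hτ => ?_⟩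
  · rw [hfg τ (upperRegion_subset_compl hτ),
      orbitExtension_of_upperRegion α β (γ := 1) (by rwa [one_smul]), autFactor_one]
    ring
  · rw [hfg τ (ellipticTriangle_subset_compl hτ),
      orbitExtension_of_ellipticTriangle α β (γ := 1) (by rwa [one_smul]), autFactor_one,
      one_smul, rhoForm]
    ring

/-! ### Classification -/

lemma upperRegion_mem_complementComponents :
    upperRegion ∈ complementComponents (exceptionalSet 5) := by
  simpa using preimage_upperRegion_mem_complementComponents 1

lemma ellipticTriangle_mem_complementComponents :
    ellipticTriangle ∈ complementComponents (exceptionalSet 5) := by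
  simpa using preimage_ellipticTriangle_mem_complementComponents 1

lemma mem_upperRegion_of_sqrt_lt_im {τ : ℍ} (h : Real.sqrt 5 / 2 < τ.im) : τ ∈ upperRegion := by
  intro n
  have h5 : Real.sqrt 5 ^ 2 = 5 := Real.sq_sqrt (by norm_num)
  have h0 := Real.sqrt_nonneg 5
  have him : 5 / 4 < τ.im ^ 2 := by nlinarith
  simp only [circleForm]
  nlinarith [sq_nonneg (τ.re - (n + 1 / 2))]

lemma eq_of_eq_on_regions {f g : ℍ → ℂ} (hf : f ∈ modularLocalPolynomials (-2) 5)
    (hg : g ∈ modularLocalPolynomials (-2) 5)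
    (h : ∀ τ ∈ upperRegion ∪ ellipticTriangle, f τ = g τ) : f = g := by
  have hoff : ∀ τ ∉ exceptionalSet 5, f τ = g τ := by
    intro τ hτ
    obtain ⟨γ, hγ⟩ := exists_smul_mem_of_notMem hτ
    rw [← (slash_neg_two_eq_iff f γ).1 (hf.slash_eq γ) τ,
      ← (slash_neg_two_eq_iff g γ).1 (hg.slash_eq γ) τ, h _ hγ]
  ext τ
  exact ((hf.hasAverageAt τ).congr hoff).unique (hg.hasAverageAt τ)

lemma exists_const_on_upperRegion {f : ℍ → ℂ} (hf : f ∈ modularLocalPolynomials (-2) 5) :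
    ∃ α : ℂ, ∀ τ ∈ upperRegion, f τ = α := by
  obtain ⟨P, hP⟩ := hf.isLocalPolynomial _ upperRegion_mem_complementComponents
  have hne : upperRegion.Nonempty := by
    obtain ⟨τ, hτ, h⟩ := upperRegion_mem_complementComponents
    exact ⟨τ, h ▸ mem_connectedComponentIn hτ⟩
  obtain ⟨z, hz⟩ := hne
  refine ⟨f z, fun τ hτ => ?_⟩
  have hper : ∀ n : ℤ, P.eval ((z : ℂ) + n) = f z := by
    intro n
    have h1 := (T_zpow_smul_mem_upperRegion_iff n z).2 hz
    have h2 := (slash_neg_two_eq_iff f _).1 (hf.slash_eq (ModularGroup.T ^ n)) z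
    rw [autFactor_sq_eq_one_of_overlap hz h1, one_mul, hP _ h1, ModularGroup.coe_T_zpow_smul_eq] at h2
    exact h2
  -- A polynomial taking one value at all `z + n` is constant.
  have hconst : P = Polynomial.C (f z) := by
    refine Polynomial.eq_of_infinite_eval_eq _ _ (Set.Infinite.mono ?_
      (Set.infinite_range_of_injective (f := fun n : ℤ => (z : ℂ) + n)
        fun a b h => by simpa using h))
    rintro _ ⟨n, rfl⟩
    simpa using hper n
  rw [hP τ hτ, hconst, Polynomial.eval_C]

/-- The generator `τ ↦ 1 / (1 - τ)` of the stabiliser of `ρ`. -/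
def rhoRotation : SL(2, ℤ) := ⟨!![0, 1; -1, 1], by simp [Matrix.det_fin_two]⟩

lemma autFactor_rhoRotation (τ : ℍ) : autFactor rhoRotation τ = 1 - τ := by
  simp [autFactor, rhoRotation]
  ring

lemma coe_rhoRotation_smul (τ : ℍ) : ((rhoRotation • τ : ℍ) : ℂ) = (1 - (τ : ℂ))⁻¹ := by
  have h := coe_smul_mul_autFactor rhoRotation τ
  have h0 := autFactor_ne_zero rhoRotation τ
  rw [autFactor_rhoRotation] at h h0
  simp [rhoRotation] at h
  exact eq_inv_of_mul_eq_one_left h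

lemma rhoRotation_smul_rhoPoint : rhoRotation • rhoPoint = rhoPoint := by
  have h := rhoForm_rhoPoint
  rw [UpperHalfPlane.ext_iff, coe_rhoRotation_smul]
  refine inv_eq_of_mul_eq_one_left ?_
  rw [rhoForm] at h
  linear_combination -h

/-- The rotation fixes `ρ`, hence preserves its component. -/
lemma rhoRotation_smul_mem {τ : ℍ} (hτ : τ ∈ ellipticTriangle) :
    rhoRotation • τ ∈ ellipticTriangle := by
  have h := connectedComponentIn_eq_preimage_smul rhoRotation
    (ellipticTriangle_subset_compl rhoPoint_mem_ellipticTriangle)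
  rw [rhoRotation_smul_rhoPoint,
    connectedComponentIn_eq_ellipticTriangle rhoPoint_mem_ellipticTriangle] at h
  rw [h] at hτ
  exact hτ

/-- A polynomial that is invariant of weight `-2` under `z ↦ 1 / (1 - z)` is a multiple of
`z² - z + 1`. -/
lemma Polynomial.eq_of_rotation_invariant {P : Polynomial ℂ} {s : Set ℂ} (hs : s.Infinite)
    (h1 : ∀ z ∈ s, (1 - z) ≠ 0) (h : ∀ z ∈ s, (1 - z) ^ 2 * P.eval (1 - z)⁻¹ = P.eval z) :
    ∃ β : ℂ, ∀ z, P.eval z = β * (z ^ 2 - z + 1) := by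
  have hrev : ∀ z ∈ s, P.reverse.eval (1 - z) = (1 - z) ^ P.natDegree * P.eval (1 - z)⁻¹ := by
    intro z hz
    have hu := h1 z hz
    let : Invertible (1 - z)⁻¹ := invertibleOfNonzero (inv_ne_zero hu)
    have := Polynomial.eval₂_reverse_mul_pow (RingHom.id ℂ) (1 - z)⁻¹ P
    rw [Polynomial.eval₂_id, Polynomial.eval₂_id, invOf_eq_inv, inv_inv] at this
    rw [← this, mul_left_comm, ← mul_pow, mul_inv_cancel₀ hu, one_pow, mul_one]
  by_cases hn : 2 < P.natDegree
  · exfalso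
    -- At `z = 1` the right side vanishes, while the left side is the leading coefficient of `P`.
    have heq : P.reverse.comp (1 - .X) = (1 - .X) ^ (P.natDegree - 2) * P := by
      refine Polynomial.eq_of_infinite_eval_eq _ _ (hs.mono fun z hz => ?_)
      simp only [Set.mem_ofPred_eq, Polynomial.eval_comp, Polynomial.eval_sub, Polynomial.eval_one,
        Polynomial.eval_X, Polynomial.eval_mul, Polynomial.eval_pow]
      rw [hrev z hz, ← h z hz, ← mul_assoc, ← pow_add, Nat.sub_add_cancel hn.le]
    have h0 := congrArg (Polynomial.eval 1) heq
    simp only [Polynomial.eval_comp, Polynomial.eval_sub, Polynomial.eval_one, Polynomial.eval_X,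
      sub_self, Polynomial.eval_mul, Polynomial.eval_pow] at h0
    rw [zero_pow (by omega), zero_mul, ← Polynomial.coeff_zero_eq_eval_zero,
      Polynomial.coeff_zero_reverse, Polynomial.leadingCoeff_eq_zero] at h0
    simp [h0] at hn
  · have hP : ∀ z, P.eval z = P.coeff 0 + P.coeff 1 * z + P.coeff 2 * z ^ 2 := by
      intro z
      rw [Polynomial.eval_eq_sum_range' (n := 3) (by omega)]
      simp [Finset.sum_range_succ]
    set a := P.coeff 0
    set b := P.coeff 1
    set c := P.coeff 2
    have heq : (.C a * (1 - .X) ^ 2 + .C b * (1 - .X) + .C c : Polynomial ℂ) =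
        .C a + .C b * .X + .C c * .X ^ 2 := by
      refine Polynomial.eq_of_infinite_eval_eq _ _ (hs.mono fun z hz => ?_)
      have hz' := h z hz
      have hu := h1 z hz
      rw [hP, hP] at hz'
      simp only [Set.mem_ofPred_eq, Polynomial.eval_sub, Polynomial.eval_one, Polynomial.eval_C,
        Polynomial.eval_X, Polynomial.eval_mul, Polynomial.eval_pow, Polynomial.eval_add]
      rw [← hz']
      field_simp
    have e0 := congrArg (Polynomial.eval 0) heq
    have e1 := congrArg (Polynomial.eval 1) heq
    simp at e0 e1
    refine ⟨a, fun z => ?_⟩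
    rw [hP]
    have hb : b = -a := by linear_combination e1
    have hc : c = a := by linear_combination e0 - e1
    rw [hb, hc]
    ring

lemma exists_eq_on_ellipticTriangle {f : ℍ → ℂ} (hf : f ∈ modularLocalPolynomials (-2) 5) :
    ∃ β : ℂ, ∀ τ ∈ ellipticTriangle, f τ = β * ((τ : ℂ) ^ 2 - (τ : ℂ) + 1) := by
  obtain ⟨P, hP⟩ := hf.isLocalPolynomial _ ellipticTriangle_mem_complementComponents
  have hinf : (((↑) : ℍ → ℂ) '' ellipticTriangle).Infinite :=
    infinite_of_mem_nhds (rhoPoint : ℂ)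
      ((UpperHalfPlane.isOpenEmbedding_coe.isOpenMap _ isOpen_ellipticTriangle).mem_nhds
        ⟨_, rhoPoint_mem_ellipticTriangle, rfl⟩)
  obtain ⟨β, hβ⟩ := Polynomial.eq_of_rotation_invariant (P := P) hinf
    (by
      rintro _ ⟨τ, -, rfl⟩
      rw [← autFactor_rhoRotation]
      exact autFactor_ne_zero _ _)
    (by
      rintro _ ⟨τ, hτ, rfl⟩
      rw [← hP τ hτ, ← coe_rhoRotation_smul, ← hP _ (rhoRotation_smul_mem hτ),
        ← autFactor_rhoRotation]
      exact (slash_neg_two_eq_iff f _).1 (hf.slash_eq rhoRotation) τ)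
  exact ⟨β, fun τ hτ => by rw [hP τ hτ, hβ]⟩

/-! ### The dimension -/

/-- The space of modular local polynomials. -/
def modularLocalPolynomialSubmodule (k D : ℤ)
    (h0 : IsModularLocalPolynomial k (exceptionalSet D) 0) : Submodule ℂ (ℍ → ℂ) where
  carrier := modularLocalPolynomials k D
  zero_mem' := h0
  add_mem' {f g} hf hg := by
    refine ⟨fun γ => ?_, fun C hC => ?_, fun τ => (hf.hasAverageAt τ).add (hg.hasAverageAt τ)⟩
    · rw [SlashAction.add_slash, hf.slash_eq, hg.slash_eq]
    · obtain ⟨P, hP⟩ := hf.isLocalPolynomial C hC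
      obtain ⟨Q, hQ⟩ := hg.isLocalPolynomial C hC
      exact ⟨P + Q, fun τ hτ => by rw [Pi.add_apply, hP τ hτ, hQ τ hτ, Polynomial.eval_add]⟩
  smul_mem' c f hf := by
    refine ⟨fun γ => ?_, fun C hC => ?_, fun τ => (hf.hasAverageAt τ).smul c⟩
    · rw [ModularForm.SL_smul_slash, hf.slash_eq]
    · obtain ⟨P, hP⟩ := hf.isLocalPolynomial C hC
      exact ⟨c • P, fun τ hτ => by rw [Pi.smul_apply, hP τ hτ, Polynomial.eval_smul]⟩

/-- Even for 0 the averaging condition has content: it requires finitely many, and at least one,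
adjacent components everywhere. -/
lemma zero_mem_modularLocalPolynomials : (0 : ℍ → ℂ) ∈ modularLocalPolynomials (-2) 5 := by
  have hloc : IsLocalPolynomial (exceptionalSet 5) 0 := fun _ _ => ⟨0, fun _ _ => by simp⟩
  refine ⟨fun γ => SlashAction.zero_slash _ _, hloc, fun τ => ?_⟩
  obtain ⟨a, ha⟩ :=
    exists_hasAverageAt hloc (finite_adjacentComponents τ) (nonempty_adjacentComponents τ)
  simpa using ha.smul 0

lemma finrank_modularLocalPolynomialSubmodule :
    Module.finrank ℂ
      (modularLocalPolynomialSubmodule (-2) 5 zero_mem_modularLocalPolynomials) = 2 := by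
  have hz : (0 : ℝ) < (2 * Complex.I).im := by simp
  have hw : (0 : ℝ) < (1 / 2 + Complex.I).im := by simp
  obtain ⟨z, hzU⟩ : ∃ z, z ∈ upperRegion :=
    ⟨_, (mem_upperRegion_of_sqrt_lt_im (τ := ⟨2 * Complex.I, hz⟩) (by
      have : Real.sqrt 5 < 4 := (Real.sqrt_lt' (by norm_num)).2 (by norm_num)
      simp
      linarith))⟩
  -- Evaluation at `w` must detect `β`, so `w` has to differ from `ρ`.
  obtain ⟨w, hwT, hw0⟩ : ∃ w ∈ ellipticTriangle, (w : ℂ) ^ 2 - w + 1 ≠ 0 := by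
    refine ⟨⟨1 / 2 + Complex.I, hw⟩, ?_, ?_⟩
    · simp only [ellipticTriangle, circleForm, Set.mem_ofPred_eq]
      norm_num
    · have : (1 / 2 + Complex.I) ^ 2 - (1 / 2 + Complex.I) + 1 = (-1 / 4 : ℂ) := by
        linear_combination Complex.I_sq
      change (1 / 2 + Complex.I) ^ 2 - (1 / 2 + Complex.I) + 1 ≠ 0
      rw [this]
      norm_num
  let ev : (ℍ → ℂ) →ₗ[ℂ] ℂ × ℂ := (LinearMap.proj z).prod (LinearMap.proj w)
  let V := modularLocalPolynomialSubmodule (-2) 5 zero_mem_modularLocalPolynomials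
  have hbij : Function.Bijective (ev.comp V.subtype) := by
    constructor
    · rw [← LinearMap.ker_eq_bot, LinearMap.ker_eq_bot']
      rintro ⟨f, hf⟩ h
      obtain ⟨α, hα⟩ := exists_const_on_upperRegion hf
      obtain ⟨β, hβ⟩ := exists_eq_on_ellipticTriangle hf
      have h1 : f z = 0 := congrArg Prod.fst h
      have h2 : f w = 0 := congrArg Prod.snd h
      rw [hα z hzU] at h1
      rw [hβ w hwT] at h2
      have h3 : β = 0 := (mul_eq_zero.1 h2).resolve_right hw0
      refine Subtype.ext (show f = 0 from
        eq_of_eq_on_regions hf zero_mem_modularLocalPolynomials ?_)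
      rintro τ (hτ | hτ)
      · rw [hα τ hτ, h1]; rfl
      · rw [hβ τ hτ, h3, zero_mul]; rfl
    · rintro ⟨a, b⟩
      obtain ⟨f, hf, h1, h2⟩ := exists_modularLocalPolynomial_eq a (b / ((w : ℂ) ^ 2 - w + 1))
      refine ⟨⟨f, hf⟩, Prod.ext (h1 z hzU) ((h2 w hwT).trans (div_mul_cancel₀ _ hw0))⟩
  rw [(LinearEquiv.ofBijective _ hbij).finrank_eq]
  simp

theorem mainTheorem4 :
    -- the modular local polynomials of weight `-2` for `D = 5` form a space of dimension `2`
    (∃ V : Submodule ℂ (ℍ → ℂ),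
      (V : Set (ℍ → ℂ)) = modularLocalPolynomials (-2) 5 ∧ Module.finrank ℂ V = 2) ∧
    -- the two components of `ℍ \ E_5`
    ∃ Cinf ∈ complementComponents (exceptionalSet 5),
    ∃ Crho ∈ complementComponents (exceptionalSet 5),
      (∀ τ : ℍ, Real.sqrt 5 / 2 < τ.im → τ ∈ Cinf) ∧ rhoPoint ∈ Crho ∧
      -- an element is determined by its values on these two components
      (∀ f ∈ modularLocalPolynomials (-2) 5, ∀ g ∈ modularLocalPolynomials (-2) 5,
        (∀ τ ∈ Cinf ∪ Crho, f τ = g τ) → f = g) ∧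
      -- every element is given by constants `α`, `β` on them
      (∀ f ∈ modularLocalPolynomials (-2) 5, ∃ α β : ℂ,
        (∀ τ ∈ Cinf, f τ = α) ∧
        (∀ τ ∈ Crho, f τ = β * ((τ : ℂ) ^ 2 - (τ : ℂ) + 1))) ∧
      -- and all `α`, `β` occur, each pair for exactly one element
      (∀ α β : ℂ, ∃! f : ℍ → ℂ, f ∈ modularLocalPolynomials (-2) 5 ∧
        (∀ τ ∈ Cinf, f τ = α) ∧
        (∀ τ ∈ Crho, f τ = β * ((τ : ℂ) ^ 2 - (τ : ℂ) + 1))) := by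
  refine ⟨⟨modularLocalPolynomialSubmodule (-2) 5 zero_mem_modularLocalPolynomials, rfl,
    finrank_modularLocalPolynomialSubmodule⟩, upperRegion, upperRegion_mem_complementComponents,
    ellipticTriangle, ellipticTriangle_mem_complementComponents,
    fun τ hτ => mem_upperRegion_of_sqrt_lt_im hτ, rhoPoint_mem_ellipticTriangle,
    fun f hf g hg h => eq_of_eq_on_regions hf hg h, fun f hf => ?_, fun α β => ?_⟩
  · obtain ⟨α, hα⟩ := exists_const_on_upperRegion hf
    obtain ⟨β, hβ⟩ := exists_eq_on_ellipticTriangle hf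
    exact ⟨α, β, hα, hβ⟩
  · obtain ⟨f, hf, h1, h2⟩ := exists_modularLocalPolynomial_eq α β
    refine ⟨f, ⟨hf, h1, h2⟩, fun g ⟨hg, g1, g2⟩ => eq_of_eq_on_regions hg hf ?_⟩
    rintro τ (hτ | hτ)
    · rw [g1 τ hτ, h1 τ hτ]
    · rw [g2 τ hτ, h2 τ hτ]
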